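/- Let $\varphi=\frac{1+\sqrt5}{2}$. For $\lambda\in(0,1)$ let $g_\lambda:[0,1]\to[0,1]$ be the Denjoy–Tichy–Uitz function: $g_\lambda(0)=0$, $g_\lambda(1)=1$, if $\frac pq<\frac rs$ are consecutive Farey fractions at which $g_\lambda$ is already defined, then $g_\lambda\bigl(\frac{p+r}{q+s}\bigr)=(1-\lambda)g_\lambda\bigl(\frac pq\bigr)+\lambda g_\lambda\bigl(\frac rs\bigr)$, and $g_\lambda$ is extended to irrational arguments by continuity. For an irrational $x=[0;a_1,a_2,\dots]\in(0,1)$ put $S^{\varphi}_t(x)=a_1+2a_2+a_3+2a_4+\dots=\sum_{i=1}^t a_i\bigl(\tfrac32+\tfrac12(-1)^i\bigr)$. **Theorem 2.** There is a real number $\varkappa_2=13.05\ldots$, more precisely $13\frac{2}{38}<\varkappa_2<13\frac{2}{37}$, which is computable to any precision (that is, a computable real number) and has the following properties. (i) If $x\in(0,1)$ is irrational and $\liminf_{t\to\infty}\frac{S^{\varphi}_{2t}(x)}{t}>\varkappa_2$ (the lower limit may be $+\infty$), then the derivative $g'_{\varphi^{-1}}(x)$ exists and equals $0$. (ii) For every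 $\delta>0$ there is an irrational $y\in(0,1)$ such that the limit $\lim_{t\to\infty}\frac{S^{\varphi}_{2t}(y)}{t}$ exists and is greater than $\varkappa_2-\delta$, and $g'_{\varphi^{-1}}(y)=+\infty$. -/

import Mathlib

open Filter Topology

noncomputable section

/-- Two consecutive Farey fractions `p / q < r / s`, together with the values `gl`, `gr` that a
function takes at `p / q` and at `r / s`. -/
structure FareyInterval where
  p : ℕ
  q : ℕ
  r : ℕ
  s : ℕ
  gl : ℝ
  gr : ℝ

namespace FareyInterval

/-- The starting interval: the function is `0` at `0 / 1` and `1` at `1 / 1`. -/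
def start : FareyInterval := ⟨0, 1, 1, 1, 0, 1⟩

/-- The mediant `(p + r) / (q + s)`. -/
def mediant (I : FareyInterval) : ℝ := ((I.p : ℝ) + I.r) / ((I.q : ℝ) + I.s)

/-- The value prescribed at the mediant. -/
def mediantValue (lam : ℝ) (I : FareyInterval) : ℝ := (1 - lam) * I.gl + lam * I.gr

/-- Insert the mediant and keep the half `[p / q, mediant)` or `[mediant, r / s)` in which `x`
lies. -/
def step (lam x : ℝ) (I : FareyInterval) : FareyInterval :=
  if x < I.mediant then ⟨I.p, I.q, I.p + I.r, I.q + I.s, I.gl, I.mediantValue lam⟩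
  else ⟨I.p + I.r, I.q + I.s, I.r, I.s, I.mediantValue lam, I.gr⟩

/-- The Farey interval around `x` after `n` insertions of a mediant. -/
def descent (lam x : ℝ) : ℕ → FareyInterval
  | 0 => start
  | n + 1 => step lam x (descent lam x n)

end FareyInterval

/-- The Denjoy–Tichy–Uitz function `g_λ` on `[0, 1]`, as the limit (supremum) of the nondecreasing
sequence of its values at the left end points of the Farey intervals around `x`. If `x` is a
Farey fraction in `[0, 1)`, then `x` itself is the left end point from some step on, so that the
value is the one prescribed by the mediant rule; otherwise the value is the extension by
continuity. (Outside `[0, 1]` the function is constant.) -/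
def denjoyTichyUitz (lam x : ℝ) : ℝ := ⨆ n : ℕ, (FareyInterval.descent lam x n).gl

/-- The `i`-th partial quotient `a_i` (`i ≥ 1`) of `x = [0; a_1, a_2, …]`. -/
def partialQuotient (x : ℝ) (i : ℕ) : ℝ :=
  ((GenContFract.of x).partDens.get? (i - 1)).getD 0

/-- `S^φ_t(x) = a_1 + 2 a_2 + a_3 + 2 a_4 + … ` (`t` terms). -/
def weightedSum (x : ℝ) (t : ℕ) : ℝ :=
  ∑ i ∈ Finset.Icc 1 t, partialQuotient x i * (3 / 2 + 1 / 2 * (-1) ^ i)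

/-- A computable real number: some computable function yields, for each `n`, a dyadic rational
that approximates `x` with error at most `2 ^ (-n)`. -/
def IsComputableReal (x : ℝ) : Prop :=
  ∃ f : ℕ → ℤ, Computable f ∧ ∀ n : ℕ, |x - (f n : ℝ) / 2 ^ n| ≤ 1 / 2 ^ n

/-- The derivative of `g` at `y` is `+∞`. -/
def HasDerivAtTop (g : ℝ → ℝ) (y : ℝ) : Prop :=
  Tendsto (fun h : ℝ => (g (y + h) - g y) / h) (𝓝[≠] 0) atTop

end

/-!
For `x = [0; a₁, a₂, …]` the descent through the Farey intervals around `x` makes `a₁ - 1` turns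
to the left, then `a₂` turns to the right, `a₃` turns to the left, and so on. For `λ = φ⁻¹` we
have `1 - λ = λ ^ 2`, so a turn to the left multiplies the increment of `g` over the interval by
`φ⁻¹` and a turn to the right by `φ⁻²`. After `t` pairs of partial quotients the increment is
therefore `φ ^ (1 - S)`, with `S` the weighted sum of the statement, while the denominators of the
interval are of the order of the continuant `K` of the first `2 t` partial quotients. Hence
`g' (x)` is governed by the `excess` `2 log K - S log φ`: the derivative is `0` if the excess of
the prefixes of `x` tends to `-∞` (`IsExpansion.hasDerivAt_zero`), and `+∞` if it tends to `+∞`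
and the partial quotients are bounded (`IsExpansion.hasDerivAtTop`). The first of these needs some
care at a point `y` which is separated from `x` by a mediant `m` much closer to `x` than the
length of the interval; there `g` is compared with its value at `m` on both sides.

As `K (U) K (V) ≤ K (U V) ≤ 2 K (U) K (V)`, the excess is superadditive under concatenation of
words, and subadditive up to a constant. The threshold, `criticalWeight`, is the supremum of the
weight per pair over all finite words of positive excess. Repeating a word of positive excess
periodically gives the second property. For the first, a duality argument (`exists_multiplier`)
provides for every `r` above the threshold a `θ > 0` with `excess W + θ (S (W) - r n (W)) ≤ 0` for
*all* words `W` of `n (W)` pairs, so that the excess of the prefixes of `x` tends to `-∞` as soon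
as their weight per pair stays above a larger number.

The numerical bounds come from the observation that the optimal words consist of pairs `7, 3` with
an occasional pair `7, 4`. The lower bound comes from powers of `(7, 3)^37 (7, 4)`, followed by
one more `7, 4` to make it strict. The upper bound is the dual inequality for the multiplier
`(4 / 9) log φ`, proved by following a linear form in the two denominators, close to the eigenform
of the pair `7, 3`, through each pair (`continuant_le`).

The threshold is computable because both a lower and an upper estimate are recognized by finite
checks. A lower estimate is certified by a word of positive excess, an upper estimate by a length
`N` and a rational multiplier for which the dual inequality holds, with a margin that absorbs the
constant of subadditivity, for all words of length `N`; since a large partial quotient only makes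
that inequality easier, finitely many words suffice (`UpperCertified.log_le`). Duality shows that
certificates exist at every precision.
-/

/-! ### Words of partial quotients and their continuants -/

/-- The effect of a pair of consecutive partial quotients `a, b` on the pair of denominators
`(q, s)` of the end points of a Farey interval. -/
def contStep (v c : ℕ × ℕ) : ℕ × ℕ :=
  (v.1 + c.2 * (c.1 * v.1 + v.2), c.1 * v.1 + v.2)

/-- The denominators reached from `v` after reading a word of pairs of partial quotients. -/
def contFold (v : ℕ × ℕ) (W : List (ℕ × ℕ)) : ℕ × ℕ := W.foldl contStep v

/-- The continuant of the word `(a₁, a₂), (a₃, a₄), …`, that is, the denominator of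
`[0; a₁, a₂, a₃, a₄, …]`. -/
def continuant (W : List (ℕ × ℕ)) : ℕ := (contFold (1, 0) W).1

/-- The weight `a₁ + 2 a₂ + a₃ + 2 a₄ + …` of a word of pairs. -/
def wordWeight (W : List (ℕ × ℕ)) : ℕ := (W.map fun c => c.1 + 2 * c.2).sum

/-- All partial quotients of the word are positive. -/
def Admissible (W : List (ℕ × ℕ)) : Prop := ∀ c ∈ W, 1 ≤ c.1 ∧ 1 ≤ c.2

theorem Admissible.append {U V : List (ℕ × ℕ)} (hU : Admissible U) (hV : Admissible V) :
    Admissible (U ++ V) := by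
  intro c hc
  rcases List.mem_append.1 hc with h | h
  exacts [hU c h, hV c h]

theorem Admissible.left {U V : List (ℕ × ℕ)} (h : Admissible (U ++ V)) : Admissible U :=
  fun c hc => h c (List.mem_append_left _ hc)

theorem Admissible.right {U V : List (ℕ × ℕ)} (h : Admissible (U ++ V)) : Admissible V :=
  fun c hc => h c (List.mem_append_right _ hc)

/-- The `n`-fold repetition of a word. -/
def wordPow (W : List (ℕ × ℕ)) (n : ℕ) : List (ℕ × ℕ) := (List.replicate n W).flatten

@[simp] theorem wordPow_zero (W : List (ℕ × ℕ)) : wordPow W 0 = [] := rfl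

theorem wordPow_succ (W : List (ℕ × ℕ)) (n : ℕ) : wordPow W (n + 1) = W ++ wordPow W n := by
  simp [wordPow, List.replicate_succ]

theorem Admissible.pow {W : List (ℕ × ℕ)} (h : Admissible W) (n : ℕ) :
    Admissible (wordPow W n) := by
  intro c hc
  simp only [wordPow, List.mem_flatten, List.mem_replicate] at hc
  obtain ⟨_, ⟨_, rfl⟩, hc⟩ := hc
  exact h c hc

@[simp] theorem length_wordPow (W : List (ℕ × ℕ)) (n : ℕ) :
    (wordPow W n).length = n * W.length := by simp [wordPow]

@[simp] theorem wordWeight_nil : wordWeight [] = 0 := rfl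

@[simp] theorem wordWeight_cons (c : ℕ × ℕ) (W : List (ℕ × ℕ)) :
    wordWeight (c :: W) = c.1 + 2 * c.2 + wordWeight W := by simp [wordWeight]

@[simp] theorem wordWeight_append (U V : List (ℕ × ℕ)) :
    wordWeight (U ++ V) = wordWeight U + wordWeight V := by simp [wordWeight]

@[simp] theorem wordWeight_wordPow (W : List (ℕ × ℕ)) (n : ℕ) :
    wordWeight (wordPow W n) = n * wordWeight W := by
  induction n with
  | zero => simp
  | succ n ih => rw [wordPow_succ, wordWeight_append, ih]; ring

@[simp] theorem contFold_nil (v : ℕ × ℕ) : contFold v [] = v := rfl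

@[simp] theorem contFold_cons (v c : ℕ × ℕ) (W : List (ℕ × ℕ)) :
    contFold v (c :: W) = contFold (contStep v c) W := rfl

theorem contFold_append (v : ℕ × ℕ) (U V : List (ℕ × ℕ)) :
    contFold v (U ++ V) = contFold (contFold v U) V := List.foldl_append

theorem contFold_linear (x y : ℕ) (u v : ℕ × ℕ) (W : List (ℕ × ℕ)) :
    contFold (x * u.1 + y * v.1, x * u.2 + y * v.2) W =
      (x * (contFold u W).1 + y * (contFold v W).1,
        x * (contFold u W).2 + y * (contFold v W).2) := by
  induction W generalizing u v with
  | nil => rfl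
  | cons c W ih =>
    rw [contFold_cons, contFold_cons, contFold_cons, ← ih]
    congr 1
    simp only [contStep, Prod.mk.injEq]
    constructor <;> ring

theorem contFold_fst (v : ℕ × ℕ) (W : List (ℕ × ℕ)) :
    (contFold v W).1 = v.1 * continuant W + v.2 * (contFold (0, 1) W).1 := by
  have := contFold_linear v.1 v.2 (1, 0) (0, 1) W
  simp only [mul_one, mul_zero, add_zero, zero_add, Prod.mk.eta] at this
  rw [this, continuant]

theorem contStep_mono {u v : ℕ × ℕ} (h1 : u.1 ≤ v.1) (h2 : u.2 ≤ v.2) (c : ℕ × ℕ) :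
    (contStep u c).1 ≤ (contStep v c).1 ∧ (contStep u c).2 ≤ (contStep v c).2 := by
  simp only [contStep]
  constructor <;> gcongr

theorem contFold_mono {u v : ℕ × ℕ} (h1 : u.1 ≤ v.1) (h2 : u.2 ≤ v.2) (W : List (ℕ × ℕ)) :
    (contFold u W).1 ≤ (contFold v W).1 ∧ (contFold u W).2 ≤ (contFold v W).2 := by
  induction W generalizing u v with
  | nil => exact ⟨h1, h2⟩
  | cons c W ih => exact ih (contStep_mono h1 h2 c).1 (contStep_mono h1 h2 c).2

theorem contFold_snd_le {W : List (ℕ × ℕ)} (hW : Admissible W) {v : ℕ × ℕ} (hv : v.2 ≤ v.1) :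
    (contFold v W).2 ≤ (contFold v W).1 := by
  induction W generalizing v with
  | nil => exact hv
  | cons c W ih =>
    refine ih (fun d hd => hW d (List.mem_cons_of_mem _ hd)) ?_
    have hc := hW c List.mem_cons_self
    simp only [contStep]
    nlinarith [hc.2, Nat.le_mul_of_pos_left (c.1 * v.1 + v.2) hc.2]

theorem contFold_zero_one_le {W : List (ℕ × ℕ)} (hW : Admissible W) :
    (contFold (0, 1) W).1 ≤ continuant W := by
  cases W with
  | nil => simp [continuant]
  | cons c W =>
    have hc := hW c List.mem_cons_self
    refine (contFold_mono ?_ ?_ W).1 <;> simp only [contStep] <;> nlinarith [hc.1, hc.2]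

theorem continuant_append (U V : List (ℕ × ℕ)) :
    continuant (U ++ V) =
      continuant U * continuant V + (contFold (1, 0) U).2 * (contFold (0, 1) V).1 := by
  rw [continuant, contFold_append, contFold_fst, ← continuant]

theorem continuant_mul_le (U V : List (ℕ × ℕ)) :
    continuant U * continuant V ≤ continuant (U ++ V) := by
  rw [continuant_append]; exact Nat.le_add_right _ _

theorem continuant_append_le {U V : List (ℕ × ℕ)} (hU : Admissible U) (hV : Admissible V) :
    continuant (U ++ V) ≤ 2 * continuant U * continuant V := by
  rw [continuant_append]
  have h1 := contFold_snd_le hU (v := (1, 0)) (by simp)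
  have h2 := contFold_zero_one_le hV
  have := Nat.mul_le_mul h1 h2
  rw [← continuant] at this
  linarith

theorem continuant_pos (W : List (ℕ × ℕ)) : 0 < continuant W := by
  have key : ∀ v : ℕ × ℕ, 0 < v.1 → 0 < (contFold v W).1 := by
    induction W with
    | nil => intro v hv; exact hv
    | cons c W ih => intro v hv; exact ih _ (by simp only [contStep]; omega)
  exact key _ one_pos

theorem continuant_pow_le (W : List (ℕ × ℕ)) (n : ℕ) :
    continuant W ^ n ≤ continuant (wordPow W n) := by
  induction n with
  | zero => simp [continuant]
  | succ n ih =>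
    rw [wordPow_succ, pow_succ']
    exact (Nat.mul_le_mul_left _ ih).trans (continuant_mul_le _ _)

/-- The logarithm of `φ ^ (- S) K ^ 2` for the continuant `K` and the weight `S` of a word, which
measures the quotient of the increment of the function by the length of the Farey interval. -/
noncomputable def excess (W : List (ℕ × ℕ)) : ℝ :=
  2 * Real.log (continuant W) - wordWeight W * Real.log Real.goldenRatio

theorem log_goldenRatio_pos : 0 < Real.log Real.goldenRatio := Real.log_pos Real.one_lt_goldenRatio

theorem excess_add_le (U V : List (ℕ × ℕ)) : excess U + excess V ≤ excess (U ++ V) := by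
  have hU : (0 : ℝ) < continuant U := by exact_mod_cast continuant_pos U
  have hV : (0 : ℝ) < continuant V := by exact_mod_cast continuant_pos V
  have h : Real.log (continuant U * continuant V) ≤ Real.log (continuant (U ++ V)) := by
    apply Real.log_le_log (by positivity)
    exact_mod_cast continuant_mul_le U V
  rw [Real.log_mul hU.ne' hV.ne'] at h
  simp only [excess, wordWeight_append, Nat.cast_add]
  linarith

theorem excess_nil : excess [] = 0 := by simp [excess, continuant]

theorem mul_excess_le (W : List (ℕ × ℕ)) (n : ℕ) : n * excess W ≤ excess (wordPow W n) := by
  induction n with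
  | zero => simp [excess_nil]
  | succ n ih =>
    rw [wordPow_succ]
    have := excess_add_le W (wordPow W n)
    push_cast
    linarith

/-- The supremum of the weights per pair over the words with positive excess. -/
noncomputable def criticalWeight : ℝ :=
  sSup {r | ∃ W, Admissible W ∧ 0 < excess W ∧ r = wordWeight W / (W.length : ℝ)}

/-! ### Bounds for the critical weight -/

theorem goldenRatio_gt : (1.6180339887 : ℝ) < Real.goldenRatio := by
  have h : (2.2360679774 : ℝ) < √5 := Real.lt_sqrt_of_sq_lt (by norm_num)
  rw [Real.goldenRatio]; linarith

theorem goldenRatio_lt : Real.goldenRatio < (1.6180339888 : ℝ) := by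
  have h : √5 < (2.2360679775 : ℝ) := (Real.sqrt_lt' (by norm_num)).2 (by norm_num)
  rw [Real.goldenRatio]; linarith

/-- The rate `β`, slightly below `φ ^ (5 / 18)`, at which the norm bound grows per unit of
weight. The exponents of `φ` here and in `pairRate` belong to the multiplier `(4 / 9) log φ`: a
bound `K ^ 2 ≤ φ ^ ((5 / 9) S + (4 / 9) r n)` excludes positive excess at a weight of `r` or more
per pair, here with `r = 731 / 56`. -/
noncomputable def weightRate : ℝ := 1.1430155

/-- The rate `Γ`, slightly below `φ ^ (731 / 252)`, at which the norm bound grows per pair. -/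
noncomputable def pairRate : ℝ := 4.03859

theorem weightRate_pow_le : weightRate ^ 252 ≤ Real.goldenRatio ^ 70 := by
  have h := goldenRatio_gt
  have h5 : weightRate ^ 18 ≤ Real.goldenRatio ^ 5 :=
    calc weightRate ^ 18 ≤ (1.6180339887 : ℝ) ^ 5 := by norm_num [weightRate]
      _ ≤ _ := by gcongr
  calc weightRate ^ 252 = (weightRate ^ 18) ^ 14 := by ring
    _ ≤ (Real.goldenRatio ^ 5) ^ 14 := by
      have : 0 < weightRate := by norm_num [weightRate]
      gcongr
    _ = _ := by ring

set_option exponentiation.threshold 1000 in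
theorem pairRate_pow_le : pairRate ^ 252 ≤ Real.goldenRatio ^ 731 := by
  have h := goldenRatio_gt
  calc pairRate ^ 252 ≤ (1.6180339887 : ℝ) ^ 731 := by norm_num [pairRate]
    _ ≤ _ := by gcongr

/-- The growth factor allowed for the linear form `q + c s` when the pair `a, b` is read. A second
partial quotient `b ≤ 2` has to leave a reserve of the factor `21 / 20`, which pays for the
unfavourable quotient `s / q` that it produces. -/
noncomputable def growthBound (a b : ℕ) : ℝ :=
  pairRate * weightRate ^ (a + 2 * b) / if b ≤ 2 then 21 / 20 else 1

/-- The form `q + c s`, for `c = 0.13663`, exceeds neither for `s = 0`, nor for `s = q / 3`, nor,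
when the reserve is available, for `s = q` the allowed growth. As the growth is a quotient of linear
forms, these three cases bound it for all admissible `s / q`. -/
def GrowthOK (a b : ℕ) (R : ℝ) : Prop :=
  1 + (a : ℝ) * b + 0.13663 * a ≤ R ∧
  3 * (1 + (a : ℝ) * b + 0.13663 * a) + (b + 0.13663) ≤ R * (3 + 0.13663) ∧
  1 + (a : ℝ) * b + 0.13663 * a + (b + 0.13663) ≤ 21 / 20 * R * (1 + 0.13663)

theorem growthOK_succ_left {a b : ℕ} (ha : 8 ≤ a) {R : ℝ} (h : GrowthOK a b R) :
    GrowthOK (a + 1) b (R * weightRate) := by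
  obtain ⟨h1, h2, h3⟩ := h
  have ha' : (8 : ℝ) ≤ a := by exact_mod_cast ha
  have hb : (0 : ℝ) ≤ b := b.cast_nonneg
  have hab : (8 : ℝ) * b ≤ a * b := by gcongr
  have hR : 0 ≤ R := le_trans (by positivity) h1
  simp only [GrowthOK, weightRate] at *
  push_cast
  refine ⟨?_, ?_, ?_⟩ <;> nlinarith

theorem growthOK_succ_right {a b : ℕ} (hb : 4 ≤ b) {R : ℝ} (h : GrowthOK a b R) :
    GrowthOK a (b + 1) (R * weightRate ^ 2) := by
  obtain ⟨h1, h2, h3⟩ := h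
  have ha : (0 : ℝ) ≤ a := a.cast_nonneg
  have hb' : (4 : ℝ) ≤ b := by exact_mod_cast hb
  have hab : (a : ℝ) * 4 ≤ a * b := by gcongr
  have hR : 0 ≤ R := le_trans (by positivity) h1
  simp only [GrowthOK, weightRate] at *
  push_cast
  refine ⟨?_, ?_, ?_⟩ <;> nlinarith

theorem growthOK_small {a b : ℕ} (ha : a ∈ Finset.Icc 1 8) (hb : b ∈ Finset.Icc 1 4) :
    GrowthOK a b (growthBound a b) := by
  rw [Finset.mem_Icc] at ha hb
  obtain ⟨ha1, ha2⟩ := ha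
  obtain ⟨hb1, hb2⟩ := hb
  simp only [GrowthOK, growthBound, weightRate, pairRate]
  interval_cases b <;> interval_cases a <;> norm_num

theorem growthOK {a b : ℕ} (ha : 1 ≤ a) (hb : 1 ≤ b) : GrowthOK a b (growthBound a b) := by
  have key : ∀ b ∈ Finset.Icc 1 4, GrowthOK a b (growthBound a b) := by
    intro b hb
    rcases le_total a 8 with h | h
    · exact growthOK_small (Finset.mem_Icc.2 ⟨ha, h⟩) hb
    · induction a, h using Nat.le_induction with
      | base => exact growthOK_small (by simp) hb
      | succ a h ih =>
        have := growthOK_succ_left h (ih (by omega))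
        convert this using 1
        simp only [growthBound]
        ring
  rcases le_total b 4 with h | h
  · exact key b (Finset.mem_Icc.2 ⟨hb, h⟩)
  · induction b, h using Nat.le_induction with
    | base => exact key 4 (by simp)
    | succ b h ih =>
      have := growthOK_succ_right h (ih (by omega))
      convert this using 1
      simp only [growthBound, if_neg (show ¬ b ≤ 2 by omega), if_neg (show ¬ b + 1 ≤ 2 by omega)]
      ring

/-- The norm bound: the form `q + c s` of the denominators is at most `Γ ^ n β ^ S`, and has a
reserve of the factor `21 / 20` unless `s ≤ q / 3`. -/
theorem contFold_bound {W : List (ℕ × ℕ)} (hW : Admissible W) {v : ℕ × ℕ} {B : ℝ}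
    (hv : v.2 ≤ v.1) (h1 : (v.1 : ℝ) + 0.13663 * v.2 ≤ B)
    (h2 : 3 * v.2 ≤ v.1 ∨ 21 / 20 * ((v.1 : ℝ) + 0.13663 * v.2) ≤ B) :
    ((contFold v W).1 : ℝ) ≤ B * (pairRate ^ W.length * weightRate ^ wordWeight W) := by
  induction W generalizing v B with
  | nil =>
    simp only [contFold_nil, List.length_nil, pow_zero, wordWeight_nil, mul_one]
    have : (0 : ℝ) ≤ v.2 := Nat.cast_nonneg _
    linarith
  | cons c W ih =>
    obtain ⟨a, b⟩ := c
    obtain ⟨ha, hb⟩ := hW (a, b) List.mem_cons_self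
    simp only at ha hb
    obtain ⟨g1, g2, g3⟩ := growthOK ha hb
    obtain ⟨q, s⟩ := v
    simp only at hv h1 h2
    have hq : (0 : ℝ) ≤ q := q.cast_nonneg
    have hs : (0 : ℝ) ≤ s := s.cast_nonneg
    have hsq : (s : ℝ) ≤ q := by exact_mod_cast hv
    set R := growthBound a b with hR
    have hR0 : 0 ≤ R := le_trans (by positivity) g1
    have hstep : ((q + b * (a * q + s) : ℕ) : ℝ) + 0.13663 * ((a * q + s : ℕ) : ℝ) ≤ B * R := by
      push_cast
      rcases h2 with h | h
      · have h' : 3 * (s : ℝ) ≤ q := by exact_mod_cast h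
        -- a combination of the cases `s = 0` and `s = q / 3`
        have e1 := mul_le_mul_of_nonneg_left g1 (sub_nonneg.2 h')
        have e2 := mul_le_mul_of_nonneg_left g2 hs
        have e3 := mul_le_mul_of_nonneg_right h1 hR0
        nlinarith
      · -- a combination of the cases `s = 0` and `s = q`
        have e1 := mul_le_mul_of_nonneg_left g1 (sub_nonneg.2 hsq)
        have e2 := mul_le_mul_of_nonneg_left g3 hs
        have e3 := mul_le_mul_of_nonneg_right h hR0
        have e4 := mul_nonneg (sub_nonneg.2 hsq) hR0
        nlinarith
    have hW' : Admissible W := fun d hd => hW d (List.mem_cons_of_mem _ hd)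
    have hΓ : 0 < pairRate * weightRate ^ (a + 2 * b) := by
      simp only [pairRate, weightRate]; positivity
    have hB0 : 0 ≤ B := le_trans (by positivity) h1
    have hfin : B * (pairRate * weightRate ^ (a + 2 * b)) *
        (pairRate ^ W.length * weightRate ^ wordWeight W) =
        B * (pairRate ^ ((a, b) :: W).length * weightRate ^ wordWeight ((a, b) :: W)) := by
      simp only [List.length_cons, wordWeight_cons]; ring
    rw [contFold_cons, ← hfin]
    have hmono : q ≤ a * q + s := le_add_right (Nat.le_mul_of_pos_left _ ha)
    have hmono' : a * q + s ≤ b * (a * q + s) := Nat.le_mul_of_pos_left _ hb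
    refine ih hW' (by simp only [contStep]; omega) ?_ ?_
    · refine hstep.trans (mul_le_mul_of_nonneg_left ?_ hB0)
      rw [hR, growthBound]
      apply div_le_self hΓ.le
      split_ifs <;> norm_num
    · by_cases hb2 : b ≤ 2
      · right
        have : 21 / 20 * R = pairRate * weightRate ^ (a + 2 * b) := by
          rw [hR, growthBound, if_pos hb2]; field_simp
        rw [← this]
        simp only [contStep]
        nlinarith
      · left
        simp only [contStep]
        have : 3 * (a * q + s) ≤ b * (a * q + s) := Nat.mul_le_mul_right _ (by omega)
        omega

theorem continuant_le {W : List (ℕ × ℕ)} (hW : Admissible W) :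
    (continuant W : ℝ) ≤ pairRate ^ W.length * weightRate ^ wordWeight W := by
  simpa [continuant] using contFold_bound hW (v := (1, 0)) (B := 1) (by simp) (by simp) (by simp)

theorem excess_pos_iff (W : List (ℕ × ℕ)) :
    0 < excess W ↔ Real.goldenRatio ^ wordWeight W < (continuant W : ℝ) ^ 2 := by
  have hK : (0 : ℝ) < continuant W := by exact_mod_cast continuant_pos W
  rw [excess, sub_pos, ← Real.log_pow, show (2 : ℝ) = (2 : ℕ) by norm_num, ← Real.log_pow,
    Real.log_lt_log_iff (pow_pos Real.goldenRatio_pos _) (pow_pos hK _)]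

theorem length_pos_of_excess_pos {W : List (ℕ × ℕ)} (h : 0 < excess W) : 0 < W.length := by
  rcases W with _ | ⟨c, W⟩
  · simp [excess_nil] at h
  · simp

theorem weight_lt_of_excess_pos {W : List (ℕ × ℕ)} (hW : Admissible W) (h : 0 < excess W) :
    56 * wordWeight W < 731 * W.length := by
  rw [excess_pos_iff] at h
  have hφ := Real.one_lt_goldenRatio
  have hφ0 := Real.goldenRatio_pos
  have h0 : (0 : ℝ) < pairRate := by norm_num [pairRate]
  have h0' : (0 : ℝ) < weightRate := by norm_num [weightRate]
  have : Real.goldenRatio ^ (126 * wordWeight W) <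
      Real.goldenRatio ^ (731 * W.length + 70 * wordWeight W) := by
    calc Real.goldenRatio ^ (126 * wordWeight W) = (Real.goldenRatio ^ wordWeight W) ^ 126 := by
          rw [← pow_mul]; ring_nf
      _ < ((continuant W : ℝ) ^ 2) ^ 126 := by gcongr
      _ = (continuant W : ℝ) ^ 252 := by ring
      _ ≤ (pairRate ^ W.length * weightRate ^ wordWeight W) ^ 252 := by
          gcongr; exact continuant_le hW
      _ = (pairRate ^ 252) ^ W.length * (weightRate ^ 252) ^ wordWeight W := by
          rw [mul_pow, ← pow_mul, ← pow_mul, ← pow_mul, ← pow_mul]; ring_nf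
      _ ≤ (Real.goldenRatio ^ 731) ^ W.length * (Real.goldenRatio ^ 70) ^ wordWeight W := by
          gcongr
          · exact pairRate_pow_le
          · exact weightRate_pow_le
      _ = _ := by rw [pow_add, pow_mul, pow_mul]
  have := (pow_lt_pow_iff_right₀ hφ).1 this
  omega

theorem weight_div_lt {W : List (ℕ × ℕ)} (hW : Admissible W) (h : 0 < excess W) :
    wordWeight W / (W.length : ℝ) < 731 / 56 := by
  have hn : (0 : ℝ) < W.length := by exact_mod_cast length_pos_of_excess_pos h
  have := weight_lt_of_excess_pos hW h
  have : (56 : ℝ) * wordWeight W < 731 * W.length := by exact_mod_cast this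
  rw [div_lt_div_iff₀ hn (by norm_num)]
  linarith

theorem criticalWeight_bddAbove :
    BddAbove {r : ℝ | ∃ W, Admissible W ∧ 0 < excess W ∧ r = wordWeight W / (W.length : ℝ)} := by
  refine ⟨731 / 56, ?_⟩
  rintro _ ⟨W, hW, h, rfl⟩
  exact (weight_div_lt hW h).le

theorem le_criticalWeight {W : List (ℕ × ℕ)} (hW : Admissible W) (h : 0 < excess W) :
    wordWeight W / (W.length : ℝ) ≤ criticalWeight :=
  le_csSup criticalWeight_bddAbove ⟨W, hW, h, rfl⟩

/-- The linear form `q + c s` grows at least by the factor `29 + 7 c` under the pair `7, 4` and at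
least by `22 + 7 c` under the pair `7, 3`. -/
theorem contStep_form_ge (v : ℕ × ℕ) :
    22.95641 * ((v.1 : ℝ) + 0.13663 * v.2) ≤
      (contStep v (7, 3)).1 + 0.13663 * (contStep v (7, 3)).2 ∧
    29.95641 * ((v.1 : ℝ) + 0.13663 * v.2) ≤
      (contStep v (7, 4)).1 + 0.13663 * (contStep v (7, 4)).2 := by
  have h1 : (0 : ℝ) ≤ v.1 := Nat.cast_nonneg _
  have h2 : (0 : ℝ) ≤ v.2 := Nat.cast_nonneg _
  simp only [contStep]
  push_cast
  constructor <;> linarith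

/-- The word `(7, 3)^37 (7, 4)`, of weight `13 + 2 / 38` per pair. -/
def nearOptimalWord : List (ℕ × ℕ) := List.replicate 37 (7, 3) ++ [(7, 4)]

theorem admissible_nearOptimalWord : Admissible nearOptimalWord := by
  intro c hc
  simp only [nearOptimalWord, List.mem_append, List.mem_replicate, List.mem_singleton] at hc
  rcases hc with ⟨_, rfl⟩ | rfl <;> norm_num

theorem nearOptimalWord_form_ge (v : ℕ × ℕ) :
    22.95641 ^ 37 * 29.95641 * ((v.1 : ℝ) + 0.13663 * v.2) ≤
      (contFold v nearOptimalWord).1 + 0.13663 * (contFold v nearOptimalWord).2 := by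
  have key : ∀ (n : ℕ) (v : ℕ × ℕ), 22.95641 ^ n * ((v.1 : ℝ) + 0.13663 * v.2) ≤
      (contFold v (List.replicate n (7, 3))).1 +
        0.13663 * (contFold v (List.replicate n (7, 3))).2 := by
    intro n
    induction n with
    | zero => intro v; simp
    | succ n ih =>
      intro v
      rw [List.replicate_succ, contFold_cons]
      refine le_trans ?_ (ih _)
      rw [pow_succ, mul_assoc]
      exact mul_le_mul_of_nonneg_left (contStep_form_ge v).1 (by positivity)
  rw [nearOptimalWord, contFold_append, contFold_cons, contFold_nil]
  refine le_trans ?_ (contStep_form_ge _).2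
  have := key 37 v
  linarith

theorem nearOptimalWord_pow_le (k : ℕ) :
    (22.95641 ^ 37 * 29.95641 : ℝ) ^ k ≤ 2 * continuant (wordPow nearOptimalWord k) := by
  have key : ∀ (v : ℕ × ℕ), (22.95641 ^ 37 * 29.95641 : ℝ) ^ k * ((v.1 : ℝ) + 0.13663 * v.2) ≤
      (contFold v (wordPow nearOptimalWord k)).1 +
        0.13663 * (contFold v (wordPow nearOptimalWord k)).2 := by
    induction k with
    | zero => intro v; simp
    | succ n ih =>
      intro v
      rw [wordPow_succ, contFold_append]
      refine le_trans ?_ (ih _)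
      rw [pow_succ, mul_assoc]
      exact mul_le_mul_of_nonneg_left (nearOptimalWord_form_ge v) (by positivity)
  have h := key (1, 0)
  have h2 : ((contFold (1, 0) (wordPow nearOptimalWord k)).2 : ℝ) ≤
      (contFold (1, 0) (wordPow nearOptimalWord k)).1 := by
    exact_mod_cast contFold_snd_le (admissible_nearOptimalWord.pow k) (by simp)
  have h3 : (0 : ℝ) ≤ (contFold (1, 0) (wordPow nearOptimalWord k)).1 := Nat.cast_nonneg _
  rw [continuant]
  norm_num at h ⊢
  linarith

theorem wordWeight_nearOptimalWord : wordWeight nearOptimalWord = 496 := by decide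

set_option exponentiation.threshold 1000 in
theorem exists_weight_gt :
    ∃ W, Admissible W ∧ 0 < excess W ∧ (13 + 2 / 38 : ℝ) < wordWeight W / (W.length : ℝ) := by
  -- the excess per period of the growth bound is positive
  have hε : 0 < 2 * Real.log (22.95641 ^ 37 * 29.95641) - 496 * Real.log Real.goldenRatio := by
    rw [sub_pos, show (496 : ℝ) = (496 : ℕ) by norm_num, ← Real.log_pow,
      show (2 : ℝ) = (2 : ℕ) by norm_num, ← Real.log_pow]
    apply Real.log_lt_log (pow_pos Real.goldenRatio_pos _)
    calc Real.goldenRatio ^ 496 ≤ (1.6180339888 : ℝ) ^ 496 :=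
          pow_le_pow_left₀ Real.goldenRatio_pos.le goldenRatio_lt.le _
      _ < _ := by norm_num
  set ε := 2 * Real.log (22.95641 ^ 37 * 29.95641) - 496 * Real.log Real.goldenRatio with hεdef
  obtain ⟨k, hk⟩ := exists_nat_gt ((2 * Real.log 2 - excess [(7, 4)]) / ε)
  rw [div_lt_iff₀ hε] at hk
  refine ⟨wordPow nearOptimalWord k ++ [(7, 4)],
    (admissible_nearOptimalWord.pow k).append (by intro c hc; simp at hc; simp [hc]), ?_, ?_⟩
  · refine lt_of_lt_of_le ?_ (excess_add_le _ _)
    have hK : (0 : ℝ) < continuant (wordPow nearOptimalWord k) := by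
      exact_mod_cast continuant_pos _
    have h := Real.log_le_log (by positivity) (nearOptimalWord_pow_le k)
    rw [Real.log_pow, Real.log_mul two_ne_zero hK.ne'] at h
    have : excess (wordPow nearOptimalWord k) ≥ k * ε - 2 * Real.log 2 := by
      rw [excess, wordWeight_wordPow, wordWeight_nearOptimalWord, hεdef]
      push_cast
      linarith
    linarith
  · have hl : nearOptimalWord.length = 38 := by simp [nearOptimalWord]
    rw [lt_div_iff₀ (by simp; positivity)]
    simp only [wordWeight_append, wordWeight_wordPow, wordWeight_nearOptimalWord, wordWeight_cons,
      wordWeight_nil, List.length_append, length_wordPow, hl, List.length_cons, List.length_nil]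
    push_cast
    linarith

theorem criticalWeight_nonempty :
    {r : ℝ | ∃ W, Admissible W ∧ 0 < excess W ∧ r = wordWeight W / (W.length : ℝ)}.Nonempty := by
  obtain ⟨W, hW, h, -⟩ := exists_weight_gt
  exact ⟨_, W, hW, h, rfl⟩

theorem exists_weight_gt_of_lt {r : ℝ} (hr : r < criticalWeight) :
    ∃ W, Admissible W ∧ 0 < excess W ∧ r < wordWeight W / (W.length : ℝ) := by
  obtain ⟨_, ⟨W, hW, he, rfl⟩, hlt⟩ := exists_lt_of_lt_csSup criticalWeight_nonempty hr
  exact ⟨W, hW, he, hlt⟩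

theorem criticalWeight_lt : criticalWeight < 13 + 2 / 37 := by
  refine lt_of_le_of_lt (b := 731 / 56) (csSup_le criticalWeight_nonempty ?_) (by norm_num)
  rintro _ ⟨W, hW, h, rfl⟩
  exact (weight_div_lt hW h).le

theorem lt_criticalWeight : 13 + 2 / 38 < criticalWeight := by
  obtain ⟨W, hW, h, hlt⟩ := exists_weight_gt
  exact hlt.trans_le (le_criticalWeight hW h)

/-! ### The multiplier above the critical weight -/

/-- Above the critical weight, a word that is too light and has positive excess and a word that is
too heavy cannot be combined to a heavy word with positive excess. -/
theorem excess_mul_le {r : ℝ} (hr : criticalWeight < r) {U V : List (ℕ × ℕ)} (hU : Admissible U)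
    (hV : Admissible V) (heU : 0 < excess U) (hSV : r * V.length < wordWeight V) :
    excess U * (wordWeight V - r * V.length) ≤ -excess V * (r * U.length - wordWeight U) := by
  have heavy : ∀ W, Admissible W → 0 < excess W → wordWeight W < r * (W.length : ℝ) := by
    intro W hW h
    have hn : (0 : ℝ) < W.length := by exact_mod_cast length_pos_of_excess_pos h
    exact (div_lt_iff₀ hn).1 ((le_criticalWeight hW h).trans_lt hr)
  have hy := heavy U hU heU
  have hx' : excess V ≤ 0 := by
    by_contra! h
    exact absurd (heavy V hV h) hSV.le.not_gt
  by_contra! h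
  set x := excess U
  set y := r * U.length - wordWeight U with hydef
  set x' := -excess V with hx'def
  set y' := wordWeight V - r * V.length with hy'def
  have hy0 : 0 < y := sub_pos.2 hy
  have hy'0 : 0 < y' := sub_pos.2 hSV
  have hlt : x' / x < y' / y := by
    rw [div_lt_div_iff₀ heU hy0]; linarith
  obtain ⟨t, ht1, ht2⟩ := exists_rat_btwn hlt
  have ht0 : (0 : ℝ) < t := lt_of_le_of_lt (div_nonneg (by simpa [hx'def] using hx') heU.le) ht1
  have htq : 0 < t := by exact_mod_cast ht0
  have hden : (0 : ℝ) < t.den := by exact_mod_cast t.den_pos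
  have hnum : ((t.num.toNat : ℕ) : ℝ) = t * t.den := by
    have h1 : ((t.num.toNat : ℕ) : ℤ) = t.num := Int.toNat_of_nonneg (Rat.num_nonneg.2 htq.le)
    have h2 : (t : ℝ) * t.den = t.num := by exact_mod_cast Rat.mul_den_eq_num t
    rw [h2]
    exact_mod_cast h1
  set i := t.num.toNat
  set j := t.den
  rw [div_lt_iff₀ heU] at ht1
  rw [lt_div_iff₀ hy0] at ht2
  -- the word `U^i V^j` is heavy and has positive excess
  have he : 0 < excess (wordPow U i ++ wordPow V j) := by
    have h1 := excess_add_le (wordPow U i) (wordPow V j)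
    have h2 := mul_excess_le U i
    have h3 := mul_excess_le V j
    rw [hnum] at h2
    have h4 : 0 < (j : ℝ) * (t * x - x') := mul_pos hden (sub_pos.2 ht1)
    have h5 : excess V = -x' := by simp [hx'def]
    rw [h5] at h3
    nlinarith
  have hw := heavy _ ((hU.pow i).append (hV.pow j)) he
  simp only [wordWeight_append, wordWeight_wordPow, List.length_append, length_wordPow] at hw
  push_cast at hw
  rw [hnum] at hw
  have h4 : 0 < (j : ℝ) * (y' - t * y) := mul_pos hden (sub_pos.2 ht2)
  rw [hydef, hy'def] at h4
  nlinarith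

theorem continuant_singleton (a b : ℕ) : continuant [(a, b)] = 1 + b * a := by
  simp [continuant, contStep]

theorem exists_lt_two_mul_log (C : ℝ) : ∃ a : ℕ, 1 ≤ a ∧ C < 2 * Real.log (a + 1) := by
  have h : Tendsto (fun a : ℕ => 2 * Real.log ((a : ℝ) + 1)) atTop atTop :=
    (Real.tendsto_log_atTop.comp
      (tendsto_atTop_add_const_right _ _ tendsto_natCast_atTop_atTop)).const_mul_atTop two_pos
  obtain ⟨a, h1, h2⟩ := ((eventually_ge_atTop 1).and (h.eventually_gt_atTop C)).exists
  exact ⟨a, h1, h2⟩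

/-- Duality: above the critical weight there is a multiplier `θ` which trades excess for weight. -/
theorem exists_multiplier {r : ℝ} (hr : criticalWeight < r) :
    ∃ θ : ℝ, 0 < θ ∧ θ < Real.log Real.goldenRatio ∧
      ∀ W, Admissible W → excess W + θ * (wordWeight W - r * W.length) ≤ 0 := by
  set L := Real.log Real.goldenRatio with hL
  have hL0 : 0 < L := log_goldenRatio_pos
  have light : ∀ W, Admissible W → 0 < excess W → 0 < r * (W.length : ℝ) - wordWeight W := by
    intro W hW h
    have hn : (0 : ℝ) < W.length := by exact_mod_cast length_pos_of_excess_pos h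
    exact sub_pos.2 ((div_lt_iff₀ hn).1 ((le_criticalWeight hW h).trans_lt hr))
  set A : Set ℝ := {x | ∃ U, Admissible U ∧ 0 < excess U ∧
    x = excess U / (r * U.length - wordWeight U)} with hA
  have hub : ∀ V, Admissible V → r * V.length < wordWeight V →
      ∀ x ∈ A, x ≤ -excess V / (wordWeight V - r * V.length) := by
    rintro V hV hSV _ ⟨U, hU, heU, rfl⟩
    rw [div_le_div_iff₀ (light U hU heU) (sub_pos.2 hSV)]
    exact excess_mul_le hr hU hV heU hSV
  obtain ⟨U₀, hU₀, heU₀, -⟩ := exists_weight_gt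
  have hA0 : A.Nonempty := ⟨_, U₀, hU₀, heU₀, rfl⟩
  obtain ⟨a₀, ha₀⟩ := exists_nat_gt r
  have adm : ∀ a, 1 ≤ a → Admissible [(a, 1)] := by intro a ha c hc; simp at hc; simp [hc, ha]
  have hexc : ∀ a : ℕ, excess [(a, 1)] = 2 * Real.log (a + 1) - (a + 2) * L := by
    intro a
    rw [excess, continuant_singleton]
    simp only [wordWeight_cons, wordWeight_nil]
    push_cast
    rw [one_mul, add_comm (1 : ℝ)]
    ring
  have hAb : BddAbove A :=
    ⟨_, hub [(a₀ + 1, 1)] (adm _ (by omega)) (by simp; linarith)⟩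
  have hθ : ∀ W, Admissible W → excess W + sSup A * (wordWeight W - r * W.length) ≤ 0 := by
    intro W hW
    rcases lt_trichotomy (wordWeight W : ℝ) (r * W.length) with h | h | h
    · rcases le_or_gt (excess W) 0 with h0 | h0
      · have : 0 ≤ sSup A := by
          obtain ⟨x, hx⟩ := hA0
          refine le_trans ?_ (le_csSup hAb hx)
          obtain ⟨U, hU, heU, rfl⟩ := hx
          exact div_nonneg heU.le (light U hU heU).le
        nlinarith
      · have := le_csSup hAb ⟨W, hW, h0, rfl⟩
        rw [div_le_iff₀ (light W hW h0)] at this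
        linarith
    · have : excess W ≤ 0 := by
        by_contra! h0
        have := light W hW h0
        linarith
      rw [h]; linarith
    · have := csSup_le hA0 (hub W hW h)
      rw [le_div_iff₀ (sub_pos.2 h)] at this
      linarith
  refine ⟨sSup A, ?_, ?_, hθ⟩
  · refine lt_of_lt_of_le ?_ (le_csSup hAb ⟨U₀, hU₀, heU₀, rfl⟩)
    exact div_pos heU₀ (light U₀ hU₀ heU₀)
  · by_contra! h
    -- a long pair `(a, 1)` has excess about `- a log φ` only
    obtain ⟨a, ha1, ha⟩ := exists_lt_two_mul_log (r * L)
    obtain ⟨a', ha'1, ha'⟩ := exists_lt_two_mul_log (2 * Real.log (a + 1) + 2 * Real.log (a₀ + 1))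
    have haa₀ : (a₀ : ℝ) < a' := by
      have h1 : 0 ≤ Real.log ((a : ℝ) + 1) := Real.log_nonneg (by simp)
      have h2 : Real.log ((a₀ : ℝ) + 1) < Real.log ((a' : ℝ) + 1) := by linarith
      have := (Real.log_lt_log_iff (by positivity) (by positivity)).1 h2
      linarith
    have h1 := hθ _ (adm a' ha'1)
    rw [hexc] at h1
    simp only [wordWeight_cons, wordWeight_nil, List.length_singleton] at h1
    push_cast at h1
    have h2 : 0 ≤ Real.log ((a₀ : ℝ) + 1) := Real.log_nonneg (by simp)
    have h3 : 0 ≤ (sSup A - L) * (a' + 2 - r) := mul_nonneg (by linarith) (by linarith)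
    nlinarith

/-! ### Certificates recognized by a primitive recursive relation -/

theorem primrec_pow : Primrec₂ ((· ^ ·) : ℕ → ℕ → ℕ) :=
  Primrec₂.unpaired'.1 Nat.Primrec.pow

theorem primrec_fib : Primrec Nat.fib := by
  have hstep : Primrec₂ fun (_ : ℕ) (p : ℕ × ℕ) => (p.2, p.1 + p.2) :=
    Primrec.pair (Primrec.snd.comp .snd)
      (Primrec.nat_add.comp (Primrec.fst.comp .snd) (Primrec.snd.comp .snd))
  exact Primrec.fst.comp (Primrec.nat_iterate (g := fun _ => (0, 1)) .id (.const _) hstep)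

theorem primrec_contStep : Primrec₂ contStep := by
  have h2 : Primrec₂ fun (v c : ℕ × ℕ) => c.1 * v.1 + v.2 :=
    Primrec.nat_add.comp (Primrec.nat_mul.comp (Primrec.fst.comp .snd) (Primrec.fst.comp .fst))
      (Primrec.snd.comp .fst)
  exact Primrec.pair (Primrec.nat_add.comp (Primrec.fst.comp .fst)
    (Primrec.nat_mul.comp (Primrec.snd.comp .snd) h2)) h2

theorem primrec_continuant : Primrec continuant :=
  Primrec.fst.comp (Primrec.list_foldl (f := fun W => W) (g := fun _ => (1, 0))
    (h := fun _ p => contStep p.1 p.2) .id (.const _)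
    (primrec_contStep.comp (Primrec.fst.comp .snd) (Primrec.snd.comp .snd)))

theorem primrec_wordWeight : Primrec wordWeight := by
  have hstep : Primrec₂ fun (_ : List (ℕ × ℕ)) (p : ℕ × (ℕ × ℕ)) =>
      p.1 + (p.2.1 + 2 * p.2.2) :=
    Primrec.nat_add.comp (Primrec.fst.comp .snd)
      (Primrec.nat_add.comp (Primrec.fst.comp (Primrec.snd.comp .snd))
        (Primrec.nat_mul.comp (.const 2) (Primrec.snd.comp (Primrec.snd.comp .snd))))
  refine (Primrec.list_foldl (f := fun W => W) (g := fun _ => 0) (h := fun _ p =>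
    p.1 + (p.2.1 + 2 * p.2.2)) .id (.const _) hstep).of_eq fun W => ?_
  have key : ∀ x : ℕ, W.foldl (fun s c => s + (c.1 + 2 * c.2)) x = x + wordWeight W := by
    induction W with
    | nil => intro x; simp
    | cons c W ih => intro x; rw [List.foldl_cons, ih, wordWeight_cons]; ring
  exact (key 0).trans (zero_add _)

/-- The pairs of positive integers at most `B`. -/
def boundedPairs (B : ℕ) : List (ℕ × ℕ) :=
  (List.range B).flatMap fun a => (List.range B).map fun b => (a + 1, b + 1)

/-- The words of length `N` of pairs of positive integers at most `B`. -/
def boundedWords (B : ℕ) : ℕ → List (List (ℕ × ℕ))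
  | 0 => [[]]
  | N + 1 => (boundedWords B N).flatMap fun W => (boundedPairs B).map fun c => c :: W

theorem mem_boundedPairs {B : ℕ} {c : ℕ × ℕ} :
    c ∈ boundedPairs B ↔ (1 ≤ c.1 ∧ c.1 ≤ B) ∧ (1 ≤ c.2 ∧ c.2 ≤ B) := by
  obtain ⟨a, b⟩ := c
  simp only [boundedPairs, List.mem_flatMap, List.mem_range, List.mem_map, Prod.mk.injEq]
  constructor
  · rintro ⟨x, hx, y, hy, rfl, rfl⟩; omega
  · rintro ⟨⟨h1, h2⟩, h3, h4⟩
    exact ⟨a - 1, by omega, b - 1, by omega, by omega, by omega⟩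

theorem mem_boundedWords {B N : ℕ} {W : List (ℕ × ℕ)} :
    W ∈ boundedWords B N ↔ W.length = N ∧ ∀ c ∈ W, c ∈ boundedPairs B := by
  induction N generalizing W with
  | zero =>
    simp only [boundedWords, List.mem_singleton, List.length_eq_zero_iff]
    constructor
    · rintro rfl; simp
    · exact fun h => h.1
  | succ N ih =>
    simp only [boundedWords, List.mem_flatMap, List.mem_map, ih]
    constructor
    · rintro ⟨V, ⟨hl, hV⟩, c, hc, rfl⟩
      refine ⟨by simp [hl], fun d hd => ?_⟩
      rcases List.mem_cons.1 hd with rfl | hd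
      exacts [hc, hV d hd]
    · rintro ⟨hl, hW⟩
      cases W with
      | nil => simp at hl
      | cons c V =>
        exact ⟨V, ⟨by simpa using hl, fun d hd => hW d (List.mem_cons_of_mem _ hd)⟩, c,
          hW c List.mem_cons_self, rfl⟩

theorem primrec_boundedPairs : Primrec boundedPairs := by
  refine Primrec.list_flatMap Primrec.list_range ?_
  refine Primrec.list_map (Primrec.list_range.comp .fst) ?_
  exact Primrec.pair (Primrec.succ.comp (Primrec.snd.comp .fst)) (Primrec.succ.comp .snd)

theorem primrec_boundedWords : Primrec₂ boundedWords := by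
  have hstep : Primrec₂ fun (B : ℕ) (p : ℕ × List (List (ℕ × ℕ))) =>
      p.2.flatMap fun W => (boundedPairs B).map fun c => c :: W := by
    refine Primrec.list_flatMap (Primrec.snd.comp .snd) ?_
    refine Primrec.list_map (primrec_boundedPairs.comp (Primrec.fst.comp .fst)) ?_
    exact Primrec.list_cons.comp .snd (Primrec.snd.comp .fst)
  refine (Primrec.nat_rec (f := fun _ : ℕ => [[]]) (.const _) hstep).of_eq fun B N => ?_
  induction N with
  | zero => rfl
  | succ N ih => simp only [boundedWords, ← ih]

/-- The data certifying that `k / 2 ^ n` approximates the critical weight: the numerator `k`, a word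
for the lower bound, and a length `N` and a multiplier `u / v` for the upper bound. -/
abbrev Certificate := ℕ × List (ℕ × ℕ) × ℕ × ℕ × ℕ

/-- The word `W` is admissible, has positive excess and weight more than `(k - 1) / 2 ^ n` per
pair. -/
def LowerCertified (n k : ℕ) (W : List (ℕ × ℕ)) : Prop :=
  Admissible W ∧ Nat.fib (wordWeight W + 2) < continuant W ^ 2 ∧
    k * W.length < 2 ^ n * wordWeight W + W.length

/-- The inequality certifying that a word, of length `N`, is compatible with the upper bound
`(k + 1) / 2 ^ n` for the critical weight; the Fibonacci number is a lower bound for a power of the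
golden ratio. -/
def UpperInequality (n k N u v : ℕ) (W : List (ℕ × ℕ)) : Prop :=
  (2 * continuant W) ^ (2 * v * 2 ^ n) ≤
    Nat.fib (2 ^ n * (v - u) * wordWeight W + u * (k + 1) * N + 1)

/-- All words of length `N` with partial quotients at most `5 v` are compatible with the upper bound
`(k + 1) / 2 ^ n`. -/
def UpperCertified (n k N u v : ℕ) : Prop :=
  (0 < N ∧ u < v) ∧ ∀ W ∈ boundedWords (5 * v) N, UpperInequality n k N u v W

/-- The certificate is correct at precision `n`. -/
def Certified (n : ℕ) (w : Certificate) : Prop :=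
  LowerCertified n w.1 w.2.1 ∧ UpperCertified n w.1 w.2.2.1 w.2.2.2.1 w.2.2.2.2

theorem primrecRel_upperInequality :
    PrimrecRel fun (W : List (ℕ × ℕ)) (p : ℕ × Certificate) =>
      UpperInequality p.1 p.2.1 p.2.2.2.1 p.2.2.2.2.1 p.2.2.2.2.2 W := by
  have cK : Primrec fun x : List (ℕ × ℕ) × (ℕ × Certificate) => continuant x.1 :=
    primrec_continuant.comp .fst
  have cS : Primrec fun x : List (ℕ × ℕ) × (ℕ × Certificate) => wordWeight x.1 :=
    primrec_wordWeight.comp .fst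
  have cn : Primrec fun x : List (ℕ × ℕ) × (ℕ × Certificate) => 2 ^ x.2.1 :=
    primrec_pow.comp (.const 2) (Primrec.fst.comp .snd)
  have c2 : Primrec fun x : List (ℕ × ℕ) × (ℕ × Certificate) => x.2.2 := Primrec.snd.comp .snd
  have ck : Primrec fun x : List (ℕ × ℕ) × (ℕ × Certificate) => x.2.2.1 := Primrec.fst.comp c2
  have c3 := Primrec.snd.comp (Primrec.snd.comp c2)
  have cN := Primrec.fst.comp c3
  have cu := Primrec.fst.comp (Primrec.snd.comp c3)
  have cv := Primrec.snd.comp (Primrec.snd.comp c3)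
  refine Primrec.nat_le.comp
    (primrec_pow.comp (Primrec.nat_mul.comp (.const 2) cK)
      (Primrec.nat_mul.comp (Primrec.nat_mul.comp (.const 2) cv) cn))
    (primrec_fib.comp (Primrec.succ.comp (Primrec.nat_add.comp
      (Primrec.nat_mul.comp (Primrec.nat_mul.comp cn (Primrec.nat_sub.comp cv cu)) cS)
      (Primrec.nat_mul.comp (Primrec.nat_mul.comp cu (Primrec.succ.comp ck)) cN))))

theorem primrecRel_certified : PrimrecRel Certified := by
  have cn : Primrec fun x : ℕ × Certificate => 2 ^ x.1 := primrec_pow.comp (.const 2) .fst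
  have ck : Primrec fun x : ℕ × Certificate => x.2.1 := Primrec.fst.comp .snd
  have cW : Primrec fun x : ℕ × Certificate => x.2.2.1 := Primrec.fst.comp (Primrec.snd.comp .snd)
  have c3 : Primrec fun x : ℕ × Certificate => x.2.2.2 := Primrec.snd.comp (Primrec.snd.comp .snd)
  have cN := Primrec.fst.comp c3
  have cu := Primrec.fst.comp (Primrec.snd.comp c3)
  have cv := Primrec.snd.comp (Primrec.snd.comp c3)
  have cS := primrec_wordWeight.comp cW
  have cl := Primrec.list_length.comp cW
  have cadm : PrimrecPred Admissible :=
    PrimrecPred.forall_mem_list (.and (Primrec.nat_le.comp (.const 1) .fst)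
      (Primrec.nat_le.comp (.const 1) .snd))
  refine PrimrecPred.and (.and (cadm.comp cW) (.and ?_ ?_)) (.and (.and ?_ ?_) ?_)
  · exact Primrec.nat_lt.comp (primrec_fib.comp (Primrec.nat_add.comp cS (.const 2)))
      (primrec_pow.comp (primrec_continuant.comp cW) (.const 2))
  · exact Primrec.nat_lt.comp (Primrec.nat_mul.comp ck cl)
      (Primrec.nat_add.comp (Primrec.nat_mul.comp cn cS) cl)
  · exact Primrec.nat_lt.comp (.const 0) cN
  · exact Primrec.nat_lt.comp cu cv
  · exact primrecRel_upperInequality.forall_mem_list.comp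
      (primrec_boundedWords.comp (Primrec.nat_mul.comp (.const 5) cv) cN) .id

/-- A real number is computable if at each precision there is a certificate, recognized by a
primitive recursive relation, whose first component is the numerator of an approximation. -/
theorem isComputableReal_of_certified {β : Type*} [Primcodable β] [Inhabited β] {x : ℝ}
    {P : ℕ → ℕ × β → Prop} (hP : PrimrecRel P)
    (hsound : ∀ n w, P n w → |x - (w.1 : ℝ) / 2 ^ n| ≤ 1 / 2 ^ n) (hex : ∀ n, ∃ w, P n w) :
    IsComputableReal x := by
  classical
  let dec : ℕ → ℕ × β := fun m => (Encodable.decode m).getD default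
  have hdec : Primrec dec := Primrec.option_getD.comp Primrec.decode (.const _)
  let Q : ℕ → ℕ → Prop := fun n m => P n (dec m)
  have hQ : PrimrecRel Q := hP.comp .fst (hdec.comp .snd)
  have hexQ : ∀ n, ∃ m, Q n m := fun n => by
    obtain ⟨w, hw⟩ := hex n
    refine ⟨Encodable.encode w, ?_⟩
    simpa only [Q, dec, Encodable.encodek, Option.getD_some] using hw
  have hcheck : Primrec₂ fun n m => decide (Q n m) := hQ.decide
  have hfind : Computable fun n => Nat.find (hexQ n) := by
    refine (Partrec.rfind (p := fun n m => (Part.some (decide (Q n m)) : Part Bool))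
      hcheck.to_comp.partrec₂).of_eq fun n => ?_
    refine Part.eq_some_iff.2 (Nat.mem_rfind.2 ⟨?_, fun hm => ?_⟩)
    · simp [Nat.find_spec (hexQ n)]
    · simp [Nat.find_min (hexQ n) hm]
  have hcast : Primrec fun k : ℕ => (k : ℤ) := by
    refine Primrec.encode_iff.1 ((Primrec.nat_mul.comp (.const 2) .id).of_eq fun k => ?_)
    rfl
  refine ⟨fun n => ((dec (Nat.find (hexQ n))).1 : ℕ), ?_, fun n => ?_⟩
  · exact hcast.to_comp.comp ((Primrec.fst.comp hdec).to_comp.comp hfind)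
  · simpa only [Int.cast_natCast] using hsound n _ (Nat.find_spec (hexQ n))

/-! ### Computability of the critical weight -/

theorem fib_succ_le (n : ℕ) : (Nat.fib (n + 1) : ℝ) ≤ Real.goldenRatio ^ n := by
  rw [← Real.fib_succ_sub_goldenConj_mul_fib]
  have := mul_nonneg (neg_nonneg.2 Real.goldenConj_neg.le) (Nat.cast_nonneg (α := ℝ) (Nat.fib n))
  linarith

theorem le_goldenRatio_mul_fib_succ (n : ℕ) :
    Real.goldenRatio ^ n ≤ Real.goldenRatio * (Nat.fib (n + 1) : ℝ) := by
  rw [← Real.fib_succ_sub_goldenConj_mul_fib]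
  have h1 : (Nat.fib n : ℝ) ≤ Nat.fib (n + 1) := by exact_mod_cast Nat.fib_le_fib_succ
  have h2 := mul_le_mul_of_nonneg_left h1 (neg_nonneg.2 Real.goldenConj_neg.le)
  have h3 := Real.goldenRatio_add_goldenConj
  rw [← eq_sub_iff_add_eq] at h3
  rw [h3]
  linarith

theorem le_fib_add_two (n : ℕ) : Real.goldenRatio ^ n ≤ Nat.fib (n + 2) := by
  rw [← Real.fib_succ_sub_goldenConj_mul_fib, Nat.fib_add_two]
  have := mul_nonneg (sub_nonneg.2 Real.neg_one_lt_goldenConj.le)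
    (Nat.cast_nonneg (α := ℝ) (Nat.fib n))
  push_cast
  linarith

theorem two_fifths_le_log_goldenRatio : 2 / 5 ≤ Real.log Real.goldenRatio := by
  rw [Real.le_log_iff_exp_le Real.goldenRatio_pos]
  refine le_of_pow_le_pow_left₀ (n := 5) (by norm_num) Real.goldenRatio_pos.le ?_
  rw [← Real.exp_nat_mul]
  have h1 := Real.exp_one_lt_d9
  have h2 := goldenRatio_gt
  calc Real.exp ((5 : ℕ) * (2 / 5)) = Real.exp 1 ^ 2 := by
        rw [← Real.exp_nat_mul]; norm_num
    _ ≤ 2.7182818286 ^ 2 := by gcongr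
    _ ≤ 1.6180339887 ^ 5 := by norm_num
    _ ≤ _ := by gcongr

/-- Replace the partial quotients larger than `B` by `B`. -/
def truncateWord (B : ℕ) (W : List (ℕ × ℕ)) : List (ℕ × ℕ) :=
  W.map fun c => (min c.1 B, min c.2 B)

theorem le_min_mul_exp {B : ℕ} (hB : 0 < B) (a : ℕ) :
    (a : ℝ) ≤ (min a B : ℕ) * Real.exp (((a : ℝ) - (min a B : ℕ)) / B) := by
  rcases le_total a B with h | h
  · simp [min_eq_left h]
  · rw [min_eq_right h]
    have hB' : (0 : ℝ) < B := by exact_mod_cast hB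
    have := Real.add_one_le_exp (((a : ℝ) - B) / B)
    have h2 := mul_le_mul_of_nonneg_left this hB'.le
    have h3 : (B : ℝ) * (((a : ℝ) - B) / B + 1) = a := by field_simp; ring
    rwa [h3] at h2

/-- The denominators are linear in each partial quotient with nonnegative coefficients, so
truncation changes them at most by the product of the quotients `a / B ≤ exp ((a - B) / B)`. -/
theorem contFold_truncate {B : ℕ} (hB : 0 < B) (W : List (ℕ × ℕ)) {u v : ℕ × ℕ} {ρ : ℝ}
    (hρ : 0 ≤ ρ) (h1 : (u.1 : ℝ) ≤ v.1 * ρ) (h2 : (u.2 : ℝ) ≤ v.2 * ρ) :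
    ((contFold u W).1 : ℝ) ≤ (contFold v (truncateWord B W)).1 *
      (ρ * Real.exp (((wordWeight W : ℝ) - wordWeight (truncateWord B W)) / B)) := by
  induction W generalizing u v ρ with
  | nil => simpa [truncateWord] using h1
  | cons c W ih =>
    obtain ⟨a, b⟩ := c
    have hB' : (0 : ℝ) < B := by exact_mod_cast hB
    have ea := le_min_mul_exp hB a
    have eb := le_min_mul_exp hB b
    set a' := min a B
    set b' := min b B
    set x := Real.exp (((a : ℝ) - a') / B) with hx
    set y := Real.exp (((b : ℝ) - b') / B) with hy
    have haa : (a' : ℝ) ≤ a := by exact_mod_cast min_le_left a B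
    have hbb : (b' : ℝ) ≤ b := by exact_mod_cast min_le_left b B
    have hx1 : 1 ≤ x := Real.one_le_exp (div_nonneg (sub_nonneg.2 haa) hB'.le)
    have hy1 : 1 ≤ y := Real.one_le_exp (div_nonneg (sub_nonneg.2 hbb) hB'.le)
    have hs : ((a * u.1 + u.2 : ℕ) : ℝ) ≤ ((a' * v.1 + v.2 : ℕ) : ℝ) * (ρ * x) := by
      push_cast
      have e1 : (a : ℝ) * u.1 ≤ (a' * x) * (v.1 * ρ) := by gcongr
      have e2 : (v.2 : ℝ) * ρ ≤ v.2 * ρ * x := le_mul_of_one_le_right (by positivity) hx1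
      linarith
    have hq : ((u.1 + b * (a * u.1 + u.2) : ℕ) : ℝ) ≤
        ((v.1 + b' * (a' * v.1 + v.2) : ℕ) : ℝ) * (ρ * x * y) := by
      push_cast at hs ⊢
      have e1 : (b : ℝ) * (a * u.1 + u.2) ≤ (b' * y) * ((a' * v.1 + v.2) * (ρ * x)) := by gcongr
      have e2 : (v.1 : ℝ) * ρ ≤ v.1 * ρ * (x * y) :=
        le_mul_of_one_le_right (by positivity) (one_le_mul_of_one_le_of_one_le hx1 hy1)
      linarith
    have hs' : ((a * u.1 + u.2 : ℕ) : ℝ) ≤ ((a' * v.1 + v.2 : ℕ) : ℝ) * (ρ * x * y) := by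
      refine hs.trans (mul_le_mul_of_nonneg_left ?_ (Nat.cast_nonneg _))
      exact le_mul_of_one_le_right (by positivity) hy1
    refine (ih (u := contStep u (a, b)) (v := contStep v (a', b')) (by positivity) hq hs').trans ?_
    simp only [truncateWord, List.map_cons, contFold_cons, wordWeight_cons]
    refine mul_le_mul_of_nonneg_left ?_ (Nat.cast_nonneg _)
    rw [hx, hy, mul_assoc, mul_assoc, ← Real.exp_add, ← Real.exp_add]
    refine mul_le_mul_of_nonneg_left (Real.exp_le_exp.2 ?_) hρ
    rw [← add_div, ← add_div]
    refine div_le_div_of_nonneg_right ?_ hB'.le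
    rw [Nat.cast_add, Nat.cast_add, Nat.cast_add, Nat.cast_add, Nat.cast_mul, Nat.cast_mul]
    push_cast [a', b'] at haa hbb ⊢
    linarith

theorem continuant_truncate {B : ℕ} (hB : 0 < B) (W : List (ℕ × ℕ)) :
    (continuant W : ℝ) ≤ continuant (truncateWord B W) *
      Real.exp (((wordWeight W : ℝ) - wordWeight (truncateWord B W)) / B) := by
  simpa [continuant] using contFold_truncate hB W (u := (1, 0)) (v := (1, 0)) zero_le_one
    (by simp) (by simp)

theorem wordWeight_truncate_le (B : ℕ) (W : List (ℕ × ℕ)) :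
    wordWeight (truncateWord B W) ≤ wordWeight W := by
  induction W with
  | nil => simp [truncateWord]
  | cons c W ih =>
    simp only [truncateWord, List.map_cons, wordWeight_cons] at ih ⊢
    have := min_le_left c.1 B
    have := min_le_left c.2 B
    omega

theorem truncateWord_mem {B : ℕ} (hB : 0 < B) {W : List (ℕ × ℕ)} (hW : Admissible W) :
    truncateWord B W ∈ boundedWords B W.length := by
  rw [mem_boundedWords]
  refine ⟨by simp [truncateWord], fun c hc => ?_⟩
  obtain ⟨d, hd, rfl⟩ := List.mem_map.1 hc
  have := hW d hd
  rw [mem_boundedPairs]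
  simp only
  omega

/-- An upper certificate controls all words of its length: the words with large partial quotients
are compared with their truncations. -/
theorem UpperCertified.log_le {n k N u v : ℕ} (h : UpperCertified n k N u v)
    {W : List (ℕ × ℕ)} (hW : Admissible W) (hl : W.length = N) :
    2 * v * 2 ^ n * (Real.log 2 + Real.log (continuant W)) ≤
      (2 ^ n * ((v : ℝ) - u) * wordWeight W + u * (k + 1) * N) * Real.log Real.goldenRatio := by
  obtain ⟨⟨hN, huv⟩, h⟩ := h
  have hv : 0 < v := by omega
  have hB : 0 < 5 * v := by omega
  set T := truncateWord (5 * v) W with hT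
  have hK : (0 : ℝ) < continuant W := by exact_mod_cast continuant_pos W
  have hKT : (0 : ℝ) < continuant T := by exact_mod_cast continuant_pos T
  have hTl := h T (hl ▸ truncateWord_mem hB hW)
  have h1 : ((2 * continuant T : ℕ) : ℝ) ^ (2 * v * 2 ^ n) ≤
      Real.goldenRatio ^ (2 ^ n * (v - u) * wordWeight T + u * (k + 1) * N) :=
    le_trans (by exact_mod_cast hTl) (fib_succ_le _)
  have h2 := Real.log_le_log (pow_pos (by push_cast; positivity) _) h1
  rw [Real.log_pow, Real.log_pow] at h2
  push_cast [Nat.cast_sub huv.le] at h2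
  rw [Real.log_mul two_ne_zero hKT.ne'] at h2
  have h3 := Real.log_le_log hK (continuant_truncate hB W)
  rw [Real.log_mul hKT.ne' (Real.exp_pos _).ne', Real.log_exp, ← hT] at h3
  have hS : (wordWeight T : ℝ) ≤ wordWeight W := by exact_mod_cast wordWeight_truncate_le _ W
  have hv' : (0 : ℝ) < v := by exact_mod_cast hv
  have huv' : (1 : ℝ) ≤ v - u := by
    have : (u : ℝ) + 1 ≤ v := by exact_mod_cast huv
    linarith
  set D := (wordWeight W : ℝ) - wordWeight T with hD
  have hD0 : 0 ≤ D := sub_nonneg.2 hS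
  have h4 : 2 * v * (D / ((5 * v : ℕ) : ℝ)) = 2 / 5 * D := by
    push_cast; field_simp
  have h5 : 2 / 5 * D ≤ Real.log Real.goldenRatio * ((v - u) * D) := by
    have := mul_le_mul two_fifths_le_log_goldenRatio (le_mul_of_one_le_left hD0 huv') hD0
      log_goldenRatio_pos.le
    exact this
  have h6 : 2 * v * 2 ^ n * (Real.log 2 + Real.log (continuant W)) ≤
      2 * v * 2 ^ n * (Real.log 2 + Real.log (continuant T)) +
        2 ^ n * (2 * v * (D / ((5 * v : ℕ) : ℝ))) := by
    have := mul_le_mul_of_nonneg_left h3 (show (0 : ℝ) ≤ 2 * v * 2 ^ n by positivity)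
    linarith
  rw [h4] at h6
  have h7 := mul_le_mul_of_nonneg_left h5 (show (0 : ℝ) ≤ 2 ^ n by positivity)
  have h8 : (wordWeight W : ℝ) = wordWeight T + D := by rw [hD]; ring
  rw [h8]
  linarith

theorem UpperCertified.log_le_of_dvd {n k N u v : ℕ} (h : UpperCertified n k N u v) (m : ℕ)
    {W : List (ℕ × ℕ)} (hW : Admissible W) (hl : W.length = m * N) :
    2 * v * 2 ^ n * Real.log (continuant W) ≤
      (2 ^ n * ((v : ℝ) - u) * wordWeight W + u * (k + 1) * (m * N)) *
        Real.log Real.goldenRatio := by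
  induction m generalizing W with
  | zero =>
    rw [zero_mul, List.length_eq_zero_iff] at hl
    subst hl
    simp [continuant]
  | succ m ih =>
    set U := W.take N with hU
    set V := W.drop N with hV
    have hUV : U ++ V = W := List.take_append_drop N W
    have hUl : U.length = N := by rw [hU, List.length_take, hl]; simp [Nat.succ_mul]
    have hVl : V.length = m * N := by rw [hV, List.length_drop, hl]; simp [Nat.succ_mul]
    have hUa : Admissible U := (hUV ▸ hW : Admissible (U ++ V)).left
    have hVa : Admissible V := (hUV ▸ hW : Admissible (U ++ V)).right
    have e1 := h.log_le hUa hUl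
    have e2 := ih hVa hVl
    have hKU : (0 : ℝ) < continuant U := by exact_mod_cast continuant_pos U
    have hKV : (0 : ℝ) < continuant V := by exact_mod_cast continuant_pos V
    have e3 : Real.log (continuant W) ≤
        Real.log 2 + Real.log (continuant U) + Real.log (continuant V) := by
      rw [← Real.log_mul two_ne_zero hKU.ne', ← Real.log_mul (by positivity) hKV.ne', ← hUV]
      apply Real.log_le_log (by exact_mod_cast continuant_pos _)
      exact_mod_cast continuant_append_le hUa hVa
    have e4 : (wordWeight W : ℝ) = wordWeight U + wordWeight V := by
      rw [← hUV, wordWeight_append]; push_cast; rfl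
    have e5 := mul_le_mul_of_nonneg_left e3 (show (0 : ℝ) ≤ 2 * v * 2 ^ n by positivity)
    rw [e4]
    push_cast
    linarith

theorem UpperCertified.criticalWeight_le {n k N u v : ℕ} (h : UpperCertified n k N u v) :
    criticalWeight ≤ ((k : ℝ) + 1) / 2 ^ n := by
  refine csSup_le criticalWeight_nonempty ?_
  rintro _ ⟨W, hW, he, rfl⟩
  have hn : (0 : ℝ) < W.length := by exact_mod_cast length_pos_of_excess_pos he
  have hN : (0 : ℝ) < N := by exact_mod_cast h.1.1
  have huv : (u : ℝ) < v := by exact_mod_cast h.1.2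
  have hv : (0 : ℝ) < v := lt_of_le_of_lt (Nat.cast_nonneg u) huv
  have e1 := h.log_le_of_dvd W.length (hW.pow N) (by rw [length_wordPow, mul_comm])
  have hK : (0 : ℝ) < continuant W := by exact_mod_cast continuant_pos W
  have e2 : N * Real.log (continuant W) ≤ Real.log (continuant (wordPow W N)) := by
    rw [← Real.log_pow]
    apply Real.log_le_log (by positivity)
    exact_mod_cast continuant_pow_le W N
  rw [excess, sub_pos] at he
  rw [wordWeight_wordPow] at e1
  push_cast at e1
  have hL := log_goldenRatio_pos
  have hc : (0 : ℝ) < v * 2 ^ n * N := by positivity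
  have e3 := mul_lt_mul_of_pos_left he hc
  have e4 := mul_le_mul_of_nonneg_left e2 (show (0 : ℝ) ≤ 2 * v * 2 ^ n by positivity)
  have e5 : (N * (v * 2 ^ n * wordWeight W)) * Real.log Real.goldenRatio <
      (N * (2 ^ n * (v - u) * wordWeight W + u * (k + 1) * W.length)) *
        Real.log Real.goldenRatio := by linarith
  have e6 := lt_of_mul_lt_mul_right e5 hL.le
  have e7 := lt_of_mul_lt_mul_left e6 hN.le
  have hu : (0 : ℝ) ≤ u := Nat.cast_nonneg _
  have e8 : (u : ℝ) * (wordWeight W * 2 ^ n) < u * ((k + 1) * W.length) := by linarith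
  rw [div_le_div_iff₀ hn (by positivity)]
  exact (lt_of_mul_lt_mul_left e8 hu).le

theorem LowerCertified.lt_criticalWeight {n k : ℕ} {W : List (ℕ × ℕ)} (h : LowerCertified n k W) :
    ((k : ℝ) - 1) / 2 ^ n < criticalWeight := by
  obtain ⟨hW, h1, h2⟩ := h
  have he : 0 < excess W := by
    rw [excess_pos_iff]
    exact (le_fib_add_two _).trans_lt (by exact_mod_cast h1)
  refine lt_of_lt_of_le ?_ (le_criticalWeight hW he)
  have hn : (0 : ℝ) < W.length := by exact_mod_cast length_pos_of_excess_pos he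
  rw [div_lt_div_iff₀ (by positivity) hn]
  have h3 : (k : ℝ) * W.length < 2 ^ n * wordWeight W + W.length := by exact_mod_cast h2
  linarith

theorem exists_lowerCertified {n k : ℕ} (h : ((k : ℝ) - 1) / 2 ^ n < criticalWeight) :
    ∃ W, LowerCertified n k W := by
  obtain ⟨W, hW, he, hlt⟩ := exists_weight_gt_of_lt h
  have hn : (0 : ℝ) < W.length := by exact_mod_cast length_pos_of_excess_pos he
  obtain ⟨j, hj⟩ := exists_nat_gt (Real.log Real.goldenRatio / excess W)
  have hj0 : (0 : ℝ) < j := lt_of_le_of_lt (div_nonneg log_goldenRatio_pos.le he.le) hj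
  rw [div_lt_iff₀ he] at hj
  have h1 := mul_excess_le W j
  refine ⟨wordPow W j, hW.pow j, ?_, ?_⟩
  · have h2 : Real.log Real.goldenRatio < excess (wordPow W j) := by linarith
    set V := wordPow W j
    have hK : (0 : ℝ) < continuant V := by exact_mod_cast continuant_pos V
    rw [excess, lt_sub_iff_add_lt, ← one_add_mul, add_comm (1 : ℝ),
      show (wordWeight V : ℝ) + 1 = ((wordWeight V + 1 : ℕ) : ℝ) by push_cast; rfl,
      ← Real.log_pow, show (2 : ℝ) = (2 : ℕ) by norm_num, ← Real.log_pow,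
      Real.log_lt_log_iff (pow_pos Real.goldenRatio_pos _) (pow_pos hK _)] at h2
    have h3 := (fib_succ_le (wordWeight V + 1)).trans_lt h2
    exact_mod_cast h3
  · rw [div_lt_div_iff₀ (by positivity) hn] at hlt
    rw [length_wordPow, wordWeight_wordPow]
    have h3 := mul_lt_mul_of_pos_left hlt hj0
    have h4 : (k : ℝ) * (j * W.length) < 2 ^ n * (j * wordWeight W) + j * W.length := by linarith
    exact_mod_cast h4

theorem exists_upperCertified {n k : ℕ} (h : criticalWeight < ((k : ℝ) + 1) / 2 ^ n) :
    ∃ N u v, UpperCertified n k N u v := by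
  set r' := ((k : ℝ) + 1) / 2 ^ n with hr'
  obtain ⟨r, hr1, hr2⟩ := exists_between h
  obtain ⟨θ, hθ0, hθL, hθ⟩ := exists_multiplier hr1
  set L := Real.log Real.goldenRatio with hL
  have hL0 : 0 < L := log_goldenRatio_pos
  have hr0 : 0 < r := lt_trans (by norm_num) (lt_criticalWeight.trans hr1)
  have hr'0 : 0 < r' := hr0.trans hr2
  have hlt : θ * r / (r' * L) < θ / L := by
    rw [div_lt_div_iff₀ (by positivity) hL0]
    have := mul_lt_mul_of_pos_left hr2 (mul_pos hθ0 hL0)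
    linarith
  obtain ⟨t, ht1, ht2⟩ := exists_rat_btwn hlt
  have ht0 : (0 : ℝ) < t := lt_trans (by positivity) ht1
  have htq : 0 < t := by exact_mod_cast ht0
  set v := t.den with hv
  have hv0 : (0 : ℝ) < v := by exact_mod_cast t.den_pos
  set u := t.num.toNat with hu
  have hut : (u : ℝ) = t * v := by
    have h1 : ((t.num.toNat : ℕ) : ℤ) = t.num := Int.toNat_of_nonneg (Rat.num_nonneg.2 htq.le)
    have h2 : (t : ℝ) * t.den = t.num := by exact_mod_cast Rat.mul_den_eq_num t
    rw [h2]
    exact_mod_cast h1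
  rw [div_lt_iff₀ (by positivity)] at ht1
  rw [lt_div_iff₀ hL0] at ht2
  have htone : (t : ℝ) < 1 := by
    by_contra! h1
    have := mul_le_mul_of_nonneg_right h1 hL0.le
    linarith
  have huv : u < v := by
    have : (u : ℝ) < v := by rw [hut]; exact mul_lt_of_lt_one_left hv0 htone
    exact_mod_cast this
  have hgap : 0 < t * L * r' - θ * r := by linarith
  obtain ⟨N, hN⟩ := exists_nat_gt ((2 * Real.log 2 + L) / (t * L * r' - θ * r))
  have hN0 : (0 : ℝ) < N := by
    refine lt_of_le_of_lt (div_nonneg ?_ hgap.le) hN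
    have := Real.log_pos one_lt_two
    linarith
  rw [div_lt_iff₀ hgap] at hN
  refine ⟨N, u, v, ⟨by exact_mod_cast hN0, huv⟩, fun W hW => ?_⟩
  rw [mem_boundedWords] at hW
  obtain ⟨hl, hW⟩ := hW
  have hadm : Admissible W := fun c hc => by
    have := mem_boundedPairs.1 (hW c hc)
    exact ⟨this.1.1, this.2.1⟩
  have h1 := hθ W hadm
  rw [hl, excess] at h1
  have hK : (0 : ℝ) < continuant W := by exact_mod_cast continuant_pos W
  set m := 2 ^ n * (v - u) * wordWeight W + u * (k + 1) * N with hm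
  have hmr : (m : ℝ) = v * 2 ^ n * ((1 - t) * wordWeight W + t * r' * N) := by
    rw [hm, hr']
    push_cast [Nat.cast_sub huv.le]
    rw [hut]
    field_simp
  have hv1 : (1 : ℝ) ≤ v * 2 ^ n := by
    have h1 : (1 : ℝ) ≤ v := by exact_mod_cast t.den_pos
    exact one_le_mul_of_one_le_of_one_le h1 (one_le_pow₀ one_le_two)
  have hS : (0 : ℝ) ≤ wordWeight W := Nat.cast_nonneg _
  have key : (2 * v * 2 ^ n : ℝ) * (Real.log 2 + Real.log (continuant W)) ≤ m * L - L := by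
    have e1 : 2 * (Real.log 2 + Real.log (continuant W)) + L ≤
        ((1 - t) * wordWeight W + t * r' * N) * L := by
      have := mul_le_mul_of_nonneg_right ht2.le hS
      linarith
    have e2 := mul_le_mul_of_nonneg_left e1 (show (0 : ℝ) ≤ v * 2 ^ n by positivity)
    have e3 := mul_le_mul_of_nonneg_right hv1 hL0.le
    rw [hmr]
    linarith
  have hfib : (0 : ℝ) < Nat.fib (m + 1) := by exact_mod_cast Nat.fib_pos.2 (Nat.succ_pos m)
  have h3 := Real.log_le_log (pow_pos Real.goldenRatio_pos _) (le_goldenRatio_mul_fib_succ m)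
  rw [Real.log_pow, Real.log_mul Real.goldenRatio_ne_zero hfib.ne', ← hL] at h3
  have h4 : Real.log (((2 * continuant W : ℕ) : ℝ) ^ (2 * v * 2 ^ n)) ≤
      Real.log (Nat.fib (m + 1)) := by
    rw [Real.log_pow]
    push_cast
    rw [Real.log_mul two_ne_zero hK.ne']
    linarith
  have h5 := (Real.log_le_log_iff (pow_pos (by push_cast; positivity) _) hfib).1 h4
  show (2 * continuant W) ^ (2 * v * 2 ^ n) ≤ Nat.fib (m + 1)
  exact_mod_cast h5

theorem isComputableReal_criticalWeight : IsComputableReal criticalWeight := by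
  refine isComputableReal_of_certified primrecRel_certified (fun n w hw => ?_) fun n => ?_
  · have h1 := hw.1.lt_criticalWeight
    have h2 := hw.2.criticalWeight_le
    rw [sub_div] at h1
    rw [add_div] at h2
    rw [abs_le]
    constructor <;> linarith
  · have h2 : (0 : ℝ) < 2 ^ n := by positivity
    have hκ : 0 ≤ criticalWeight * 2 ^ n :=
      mul_nonneg (le_trans (by norm_num) lt_criticalWeight.le) h2.le
    set k := ⌊criticalWeight * 2 ^ n⌋₊
    obtain ⟨W, hW⟩ := exists_lowerCertified (n := n) (k := k) (by
      rw [div_lt_iff₀ h2]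
      have := Nat.floor_le hκ
      linarith)
    obtain ⟨N, u, v, hu⟩ := exists_upperCertified (n := n) (k := k) (by
      rw [lt_div_iff₀ h2]
      exact Nat.lt_floor_add_one _)
    exact ⟨(k, W, N, u, v), hW, hu⟩

/-! ### Descent through the Farey intervals -/

namespace FareyInterval

/-- The fractions of the interval are consecutive Farey fractions, the value at the left end point
is smaller than the value at the right end point, and `y` lies in `[p / q, r / s)`. -/
structure Around (I : FareyInterval) (y : ℝ) : Prop where
  q_pos : 0 < I.q
  s_pos : 0 < I.s
  det : I.r * I.q = I.p * I.s + 1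
  gl_lt : I.gl < I.gr
  left_le : (I.p : ℝ) ≤ y * I.q
  lt_right : y * I.s < I.r

/-- The increment of the function over the interval. -/
def increment (I : FareyInterval) : ℝ := I.gr - I.gl

variable {lam x y : ℝ} {I : FareyInterval}

theorem lt_mediant_iff (h : I.Around x) : y < I.mediant ↔ y * ((I.q : ℝ) + I.s) < I.p + I.r := by
  have : (0 : ℝ) < I.q := by exact_mod_cast h.q_pos
  rw [mediant, lt_div_iff₀ (by positivity)]

theorem Around.det_real (h : I.Around x) : (I.r : ℝ) * I.q = I.p * I.s + 1 := by
  exact_mod_cast h.det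

theorem Around.increment_pos (h : I.Around x) : 0 < I.increment := sub_pos.2 h.gl_lt

theorem step_of_lt (h : x < I.mediant) : step lam x I =
    ⟨I.p, I.q, I.p + I.r, I.q + I.s, I.gl, I.mediantValue lam⟩ := if_pos h

theorem step_of_le (h : I.mediant ≤ x) : step lam x I =
    ⟨I.p + I.r, I.q + I.s, I.r, I.s, I.mediantValue lam, I.gr⟩ := if_neg h.not_gt

theorem Around.gl_lt_mediantValue (h : I.Around x) (h0 : 0 < lam) : I.gl < I.mediantValue lam := by
  have := mul_pos h0 h.increment_pos
  rw [mediantValue]; rw [increment] at this; linarith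

theorem Around.mediantValue_lt_gr (h : I.Around x) (h1 : lam < 1) : I.mediantValue lam < I.gr := by
  have := mul_pos (sub_pos.2 h1) h.increment_pos
  rw [mediantValue]; rw [increment] at this; linarith

theorem Around.step (h : I.Around y) (h0 : 0 < lam) (h1 : lam < 1) :
    (step lam y I).Around y := by
  have hq := h.q_pos
  have hs := h.s_pos
  have hd := h.det
  rcases lt_or_ge y I.mediant with hlt | hle
  · rw [step_of_lt hlt]
    rw [lt_mediant_iff h] at hlt
    refine ⟨hq, by simp only; omega, by simp only; linarith, h.gl_lt_mediantValue h0, h.left_le, ?_⟩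
    push_cast; exact hlt
  · rw [step_of_le hle]
    rw [← not_lt, lt_mediant_iff h, not_lt] at hle
    refine ⟨by simp only; omega, hs, by simp only; linarith, h.mediantValue_lt_gr h1, ?_,
      h.lt_right⟩
    push_cast; exact hle

theorem around_start (hy0 : 0 ≤ y) (hy1 : y < 1) : start.Around y := by
  refine ⟨?_, ?_, ?_, ?_, ?_, ?_⟩ <;> simp [start, hy0, hy1]

theorem around_descent (h0 : 0 < lam) (h1 : lam < 1) (hy0 : 0 ≤ y) (hy1 : y < 1) (n : ℕ) :
    (descent lam y n).Around y := by
  induction n with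
  | zero => exact around_start hy0 hy1
  | succ n ih => exact ih.step h0 h1

theorem descent_of_lt {n : ℕ} (h : x < (descent lam x n).mediant) : descent lam x (n + 1) =
    ⟨(descent lam x n).p, (descent lam x n).q, (descent lam x n).p + (descent lam x n).r,
      (descent lam x n).q + (descent lam x n).s, (descent lam x n).gl,
      (descent lam x n).mediantValue lam⟩ := step_of_lt h

theorem descent_of_le {n : ℕ} (h : (descent lam x n).mediant ≤ x) : descent lam x (n + 1) =
    ⟨(descent lam x n).p + (descent lam x n).r, (descent lam x n).q + (descent lam x n).s,
      (descent lam x n).r, (descent lam x n).s, (descent lam x n).mediantValue lam,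
      (descent lam x n).gr⟩ := step_of_le h

/-- `y` lies in the interval `[p / q, r / s)`. -/
def Contains (I : FareyInterval) (y : ℝ) : Prop := (I.p : ℝ) ≤ y * I.q ∧ y * I.s < I.r

theorem contains_of_step (hx : I.Around x) (h : (step lam x I).Contains y) :
    I.Contains y ∧ (y < I.mediant ↔ x < I.mediant) := by
  rw [lt_mediant_iff hx (y := y)]
  rcases lt_or_ge x I.mediant with hlt | hle
  · rw [step_of_lt hlt] at h
    obtain ⟨h1, h2⟩ := h
    push_cast at h1 h2
    exact ⟨⟨h1, by linarith⟩, iff_of_true h2 hlt⟩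
  · rw [step_of_le hle] at h
    obtain ⟨h1, h2⟩ := h
    push_cast at h1 h2
    exact ⟨⟨by linarith, h2⟩, iff_of_false h1.not_gt hle.not_gt⟩

/-- Points of the same Farey interval have the same descent up to this interval. -/
theorem descent_eq_of_contains (h0 : 0 < lam) (h1 : lam < 1) (hx0 : 0 ≤ x) (hx1 : x < 1) {n : ℕ}
    (h : (descent lam x n).Contains y) : descent lam y n = descent lam x n := by
  induction n with
  | zero => rfl
  | succ n ih =>
    obtain ⟨hc, hiff⟩ := contains_of_step (around_descent h0 h1 hx0 hx1 n) h
    show step lam y (descent lam y n) = step lam x (descent lam x n)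
    rw [ih hc]
    simp only [step, hiff]

theorem unit_of_contains (h0 : 0 < lam) (h1 : lam < 1) (hx0 : 0 ≤ x) (hx1 : x < 1) {n : ℕ}
    (h : (descent lam x n).Contains y) : 0 ≤ y ∧ y < 1 := by
  induction n with
  | zero => simpa [Contains, descent, start] using h
  | succ n ih => exact ih (contains_of_step (around_descent h0 h1 hx0 hx1 n) h).1

theorem gl_monotone (h0 : 0 < lam) (h1 : lam < 1) (hy0 : 0 ≤ y) (hy1 : y < 1) :
    Monotone fun n => (descent lam y n).gl := by
  refine monotone_nat_of_le_succ fun n => ?_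
  rcases lt_or_ge y (descent lam y n).mediant with h | h
  · rw [descent_of_lt h]
  · rw [descent_of_le h]
    exact ((around_descent h0 h1 hy0 hy1 n).gl_lt_mediantValue h0).le

theorem gr_antitone (h0 : 0 < lam) (h1 : lam < 1) (hy0 : 0 ≤ y) (hy1 : y < 1) :
    Antitone fun n => (descent lam y n).gr := by
  refine antitone_nat_of_succ_le fun n => ?_
  rcases lt_or_ge y (descent lam y n).mediant with h | h
  · rw [descent_of_lt h]
    exact ((around_descent h0 h1 hy0 hy1 n).mediantValue_lt_gr h1).le
  · rw [descent_of_le h]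

theorem gl_le_gr (h0 : 0 < lam) (h1 : lam < 1) (hy0 : 0 ≤ y) (hy1 : y < 1) (m n : ℕ) :
    (descent lam y m).gl ≤ (descent lam y n).gr :=
  (gl_monotone h0 h1 hy0 hy1 (le_max_left m n)).trans
    ((around_descent h0 h1 hy0 hy1 (max m n)).gl_lt.le.trans
      (gr_antitone h0 h1 hy0 hy1 (le_max_right m n)))

theorem gl_le_denjoy (h0 : 0 < lam) (h1 : lam < 1) (hy0 : 0 ≤ y) (hy1 : y < 1) (n : ℕ) :
    (descent lam y n).gl ≤ denjoyTichyUitz lam y :=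
  le_ciSup (f := fun n => (descent lam y n).gl)
    ⟨(descent lam y 0).gr, by rintro _ ⟨m, rfl⟩; exact gl_le_gr h0 h1 hy0 hy1 m 0⟩ n

theorem denjoy_le_gr (h0 : 0 < lam) (h1 : lam < 1) (hy0 : 0 ≤ y) (hy1 : y < 1) (n : ℕ) :
    denjoyTichyUitz lam y ≤ (descent lam y n).gr :=
  ciSup_le fun m => gl_le_gr h0 h1 hy0 hy1 m n

theorem denjoy_eq_gl (h0 : 0 < lam) (h1 : lam < 1) (hy0 : 0 ≤ y) (hy1 : y < 1) {n : ℕ}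
    (h : y * (descent lam y n).q = (descent lam y n).p) :
    denjoyTichyUitz lam y = (descent lam y n).gl := by
  have key : ∀ k, y * (descent lam y (n + k)).q = (descent lam y (n + k)).p ∧
      (descent lam y (n + k)).gl = (descent lam y n).gl := by
    intro k
    induction k with
    | zero => exact ⟨h, rfl⟩
    | succ k ih =>
      have ha := around_descent h0 h1 hy0 hy1 (n + k)
      have hlt : y < (descent lam y (n + k)).mediant := by
        rw [lt_mediant_iff ha]
        linarith [ih.1, ha.lt_right]
      rw [← add_assoc, descent_of_lt hlt]
      exact ih
  refine le_antisymm (ciSup_le fun m => ?_) (gl_le_denjoy h0 h1 hy0 hy1 n)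
  rw [← (key m).2]
  exact gl_monotone h0 h1 hy0 hy1 (Nat.le_add_left m n)

/-- The right end point does not move until the descent turns left again. -/
theorem exists_next_left {n : ℕ} (hn : x < (descent lam x n).mediant)
    (h : ∃ m, n < m ∧ x < (descent lam x m).mediant) :
    ∃ m, n < m ∧ x < (descent lam x m).mediant ∧
      (descent lam x m).r = (descent lam x n).p + (descent lam x n).r ∧
      (descent lam x m).s = (descent lam x n).q + (descent lam x n).s ∧
      (descent lam x m).gr = (descent lam x n).mediantValue lam ∧
      ∀ m', n < m' → x < (descent lam x m').mediant → m ≤ m' := by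
  classical
  obtain ⟨hm1, hm2⟩ := Nat.find_spec h
  have hmin : ∀ m', n < m' → x < (descent lam x m').mediant → Nat.find h ≤ m' :=
    fun m' h1 h2 => Nat.find_min' h ⟨h1, h2⟩
  have key : ∀ k, n + 1 + k ≤ Nat.find h →
      (descent lam x (n + 1 + k)).r = (descent lam x n).p + (descent lam x n).r ∧
      (descent lam x (n + 1 + k)).s = (descent lam x n).q + (descent lam x n).s ∧
      (descent lam x (n + 1 + k)).gr = (descent lam x n).mediantValue lam := by
    intro k
    induction k with
    | zero => intro _; rw [add_zero, descent_of_lt hn]; exact ⟨rfl, rfl, rfl⟩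
    | succ k ih =>
      intro hk
      have hle : (descent lam x (n + 1 + k)).mediant ≤ x := by
        by_contra! hlt
        have := hmin _ (by omega) hlt
        omega
      rw [← add_assoc, descent_of_le hle]
      exact ih (by omega)
  obtain ⟨k, hk⟩ := Nat.exists_eq_add_of_le (Nat.succ_le_of_lt hm1)
  have := key k hk.ge
  rw [← Nat.succ_eq_add_one, ← hk] at this
  exact ⟨_, hm1, hm2, this.1, this.2.1, this.2.2, hmin⟩

/-- The left end point does not move until the descent turns right again. -/
theorem exists_next_right {n : ℕ} (hn : (descent lam x n).mediant ≤ x)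
    (h : ∃ m, n < m ∧ (descent lam x m).mediant ≤ x) :
    ∃ m, n < m ∧ (descent lam x m).mediant ≤ x ∧
      (descent lam x m).p = (descent lam x n).p + (descent lam x n).r ∧
      (descent lam x m).q = (descent lam x n).q + (descent lam x n).s ∧
      (descent lam x m).gl = (descent lam x n).mediantValue lam ∧
      ∀ m', n < m' → (descent lam x m').mediant ≤ x → m ≤ m' := by
  classical
  obtain ⟨hm1, hm2⟩ := Nat.find_spec h
  have hmin : ∀ m', n < m' → (descent lam x m').mediant ≤ x → Nat.find h ≤ m' :=
    fun m' h1 h2 => Nat.find_min' h ⟨h1, h2⟩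
  have key : ∀ k, n + 1 + k ≤ Nat.find h →
      (descent lam x (n + 1 + k)).p = (descent lam x n).p + (descent lam x n).r ∧
      (descent lam x (n + 1 + k)).q = (descent lam x n).q + (descent lam x n).s ∧
      (descent lam x (n + 1 + k)).gl = (descent lam x n).mediantValue lam := by
    intro k
    induction k with
    | zero => intro _; rw [add_zero, descent_of_le hn]; exact ⟨rfl, rfl, rfl⟩
    | succ k ih =>
      intro hk
      have hlt : x < (descent lam x (n + 1 + k)).mediant := by
        by_contra! hle
        have := hmin _ (by omega) hle
        omega
      rw [← add_assoc, descent_of_lt hlt]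
      exact ih (by omega)
  obtain ⟨k, hk⟩ := Nat.exists_eq_add_of_le (Nat.succ_le_of_lt hm1)
  have := key k hk.ge
  rw [← Nat.succ_eq_add_one, ← hk] at this
  exact ⟨_, hm1, hm2, this.1, this.2.1, this.2.2, hmin⟩

/-- The increment over the interval times the squared denominator of its mediant. -/
def density (I : FareyInterval) : ℝ := I.increment * ((I.q : ℝ) + I.s) ^ 2

end FareyInterval

/-! ### Difference quotients across a mediant -/

namespace FareyInterval

variable {lam x y : ℝ}

/-- Beyond the mediant `m` of the interval, at a distance of at least the order `1 / k` (in units of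
the squared denominator), the function exceeds its value at `m` at most by the `k`-th power of
`λ`. -/
theorem denjoy_right_of_mediant (h0 : 0 < lam) (h1 : lam < 1) (hx0 : 0 ≤ x) (hx1 : x < 1) {n : ℕ}
    (hn : x < (descent lam x n).mediant) (hy : (descent lam x n).Contains y)
    (hmy : (descent lam x n).mediant ≤ y) :
    ∃ k : ℕ, denjoyTichyUitz lam y - (descent lam x n).mediantValue lam ≤
        lam ^ k * (descent lam x n).increment *
          ((k + 2) * ((descent lam x n).q + (descent lam x n).s : ℝ) ^ 2 * (y - x)) := by
  have ha := around_descent h0 h1 hx0 hx1 n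
  obtain ⟨hy0, hy1⟩ := unit_of_contains h0 h1 hx0 hx1 hy
  have hdy := descent_eq_of_contains h0 h1 hx0 hx1 hy
  rw [lt_mediant_iff ha] at hn
  have hmy' := hmy
  rw [← not_lt, lt_mediant_iff ha, not_lt] at hmy'
  have hdet := ha.det_real
  have hμ := ha.increment_pos
  have hq1 : (1 : ℝ) ≤ (descent lam x n).q := by exact_mod_cast ha.q_pos
  have hs1 : (1 : ℝ) ≤ (descent lam x n).s := by exact_mod_cast ha.s_pos
  have hlt := hy.2
  have hD0 : descent lam y (n + 1) = ⟨(descent lam x n).p + (descent lam x n).r,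
      (descent lam x n).q + (descent lam x n).s, (descent lam x n).r, (descent lam x n).s,
      (descent lam x n).mediantValue lam, (descent lam x n).gr⟩ := by
    rw [descent_of_le (by rw [hdy]; exact hmy), hdy]
  set I := descent lam x n with hI
  set s : ℝ := (I.q : ℝ) + I.s with hs
  have hs0 : 0 < s := by linarith
  set P : ℝ := (I.p : ℝ) + I.r with hP
  have hyx : 0 < y - x := by
    have : 0 < (y - x) * s := by linarith
    exact pos_of_mul_pos_left this hs0.le
  rcases hmy'.eq_or_lt with heq | hgt
  · refine ⟨0, ?_⟩
    rw [denjoy_eq_gl h0 h1 hy0 hy1 (n := n + 1) (by rw [hD0]; push_cast; exact heq.symm), hD0]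
    simp only [sub_self]
    positivity
  have hd0 : 0 < y * s - P := sub_pos.2 hgt
  -- the largest `k` such that `y` lies to the left of the `k`-th mediant at `m`
  have hex : ∃ k : ℕ, (I.r : ℝ) - y * I.s ≤ k * (y * s - P) := by
    obtain ⟨k, hk⟩ := exists_nat_ge (((I.r : ℝ) - y * I.s) / (y * s - P))
    exact ⟨k, (div_le_iff₀ hd0).1 hk⟩
  classical
  have hfind := Nat.find_spec hex
  have hfmin : ∀ j < Nat.find hex, j * (y * s - P) < (I.r : ℝ) - y * I.s :=
    fun j hj => not_le.1 (Nat.find_min hex hj)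
  have hne : Nat.find hex ≠ 0 := by
    intro h
    rw [h, Nat.cast_zero, zero_mul] at hfind
    linarith
  obtain ⟨k, hk⟩ := Nat.exists_eq_succ_of_ne_zero hne
  rw [hk] at hfind hfmin
  have key : ∀ j ≤ k, (descent lam y (n + 1 + j)).p = I.p + I.r ∧
      (descent lam y (n + 1 + j)).q = I.q + I.s ∧
      (descent lam y (n + 1 + j)).r = j * (I.p + I.r) + I.r ∧
      (descent lam y (n + 1 + j)).s = j * (I.q + I.s) + I.s ∧
      (descent lam y (n + 1 + j)).gl = I.mediantValue lam ∧
      (descent lam y (n + 1 + j)).gr - I.mediantValue lam = lam ^ j * (1 - lam) * I.increment := by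
    intro j
    induction j with
    | zero =>
      intro _
      rw [add_zero, hD0]
      refine ⟨rfl, rfl, by simp, by simp, rfl, ?_⟩
      simp only [mediantValue, increment]; ring
    | succ j ih =>
      intro hj
      obtain ⟨e1, e2, e3, e4, e5, e6⟩ := ih (by omega)
      have hlt' : y < (descent lam y (n + 1 + j)).mediant := by
        rw [lt_mediant_iff (around_descent h0 h1 hy0 hy1 _), e1, e2, e3, e4]
        have := hfmin (j + 1) (by omega)
        push_cast at this ⊢
        rw [hs, hP] at this
        linarith
      rw [← add_assoc, descent_of_lt hlt']
      refine ⟨e1, e2, ?_, ?_, e5, ?_⟩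
      · simp only [e1, e3]; ring
      · simp only [e2, e4]; ring
      · simp only [mediantValue, e5] at e6 ⊢
        rw [pow_succ]
        linear_combination lam * e6
  refine ⟨k, ?_⟩
  have h3 := denjoy_le_gr h0 h1 hy0 hy1 (n + 1 + k)
  obtain ⟨-, -, -, -, -, e6⟩ := key k le_rfl
  have hpow : 0 ≤ lam ^ k * I.increment := by positivity
  have hfar : 1 ≤ (k + 2) * s ^ 2 * (y - x) := by
    push_cast at hfind
    have e1 := mul_le_mul_of_nonneg_left hfind hs0.le
    have e2 : 1 ≤ (y * s - P) * ((k + 1) * s + I.s) := by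
      have : s * I.r - I.s * P = 1 := by rw [hs, hP]; linear_combination hdet
      nlinarith
    have e3 : (y * s - P) ≤ (y - x) * s := by linarith
    have e4 : (k + 1) * s + I.s ≤ (k + 2) * s := by linarith
    calc (1 : ℝ) ≤ (y * s - P) * ((k + 1) * s + I.s) := e2
      _ ≤ ((y - x) * s) * ((k + 2) * s) := by
        apply mul_le_mul e3 e4 (by positivity) (by positivity)
      _ = _ := by ring
  calc denjoyTichyUitz lam y - I.mediantValue lam ≤ lam ^ k * (1 - lam) * I.increment := by
        rw [← e6]; linarith
    _ ≤ lam ^ k * I.increment := by nlinarith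
    _ ≤ _ := le_mul_of_one_le_right hpow hfar

/-- The mirror image of `denjoy_right_of_mediant`. -/
theorem denjoy_left_of_mediant (h0 : 0 < lam) (h1 : lam < 1) (hx0 : 0 ≤ x) (hx1 : x < 1) {n : ℕ}
    (hn : (descent lam x n).mediant ≤ x) (hy : (descent lam x n).Contains y)
    (hmy : y < (descent lam x n).mediant) :
    ∃ k : ℕ, (descent lam x n).mediantValue lam - denjoyTichyUitz lam y ≤
        (1 - lam) ^ k * (descent lam x n).increment *
          ((k + 2) * ((descent lam x n).q + (descent lam x n).s : ℝ) ^ 2 * (x - y)) := by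
  have ha := around_descent h0 h1 hx0 hx1 n
  obtain ⟨hy0, hy1⟩ := unit_of_contains h0 h1 hx0 hx1 hy
  have hdy := descent_eq_of_contains h0 h1 hx0 hx1 hy
  rw [← not_lt, lt_mediant_iff ha, not_lt] at hn
  have hmy' := hmy
  rw [lt_mediant_iff ha] at hmy'
  have hdet := ha.det_real
  have hμ := ha.increment_pos
  have hq1 : (1 : ℝ) ≤ (descent lam x n).q := by exact_mod_cast ha.q_pos
  have hs1 : (1 : ℝ) ≤ (descent lam x n).s := by exact_mod_cast ha.s_pos
  have hle := hy.1
  have hD0 : descent lam y (n + 1) = ⟨(descent lam x n).p, (descent lam x n).q,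
      (descent lam x n).p + (descent lam x n).r, (descent lam x n).q + (descent lam x n).s,
      (descent lam x n).gl, (descent lam x n).mediantValue lam⟩ := by
    rw [descent_of_lt (by rw [hdy]; exact hmy), hdy]
  set I := descent lam x n with hI
  set s : ℝ := (I.q : ℝ) + I.s with hs
  have hs0 : 0 < s := by linarith
  set P : ℝ := (I.p : ℝ) + I.r with hP
  have hyx : 0 < x - y := by
    have : 0 < (x - y) * s := by linarith
    exact pos_of_mul_pos_left this hs0.le
  have h1' : 0 < 1 - lam := sub_pos.2 h1
  have hd0 : 0 < P - y * s := sub_pos.2 hmy'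
  have hex : ∃ k : ℕ, y * I.q - I.p < k * (P - y * s) := by
    obtain ⟨k, hk⟩ := exists_nat_gt ((y * I.q - I.p) / (P - y * s))
    exact ⟨k, (div_lt_iff₀ hd0).1 hk⟩
  classical
  have hfind := Nat.find_spec hex
  have hfmin : ∀ j < Nat.find hex, j * (P - y * s) ≤ y * I.q - I.p :=
    fun j hj => not_lt.1 (Nat.find_min hex hj)
  have hne : Nat.find hex ≠ 0 := by
    intro h
    rw [h, Nat.cast_zero, zero_mul] at hfind
    linarith
  obtain ⟨k, hk⟩ := Nat.exists_eq_succ_of_ne_zero hne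
  rw [hk] at hfind hfmin
  have key : ∀ j ≤ k, (descent lam y (n + 1 + j)).p = I.p + j * (I.p + I.r) ∧
      (descent lam y (n + 1 + j)).q = I.q + j * (I.q + I.s) ∧
      (descent lam y (n + 1 + j)).r = I.p + I.r ∧
      (descent lam y (n + 1 + j)).s = I.q + I.s ∧
      (descent lam y (n + 1 + j)).gr = I.mediantValue lam ∧
      I.mediantValue lam - (descent lam y (n + 1 + j)).gl =
        (1 - lam) ^ j * lam * I.increment := by
    intro j
    induction j with
    | zero =>
      intro _
      rw [add_zero, hD0]
      refine ⟨by simp, by simp, rfl, rfl, rfl, ?_⟩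
      simp only [mediantValue, increment]; ring
    | succ j ih =>
      intro hj
      obtain ⟨e1, e2, e3, e4, e5, e6⟩ := ih (by omega)
      have hle' : (descent lam y (n + 1 + j)).mediant ≤ y := by
        rw [← not_lt, lt_mediant_iff (around_descent h0 h1 hy0 hy1 _), e1, e2, e3, e4, not_lt]
        have := hfmin (j + 1) (by omega)
        push_cast at this ⊢
        rw [hs, hP] at this
        linarith
      rw [← add_assoc, descent_of_le hle']
      refine ⟨?_, ?_, e3, e4, e5, ?_⟩
      · simp only [e1, e3]; ring
      · simp only [e2, e4]; ring
      · simp only [mediantValue, e5] at e6 ⊢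
        rw [pow_succ]
        linear_combination (1 - lam) * e6
  refine ⟨k, ?_⟩
  have h3 := gl_le_denjoy h0 h1 hy0 hy1 (n + 1 + k)
  obtain ⟨-, -, -, -, -, e6⟩ := key k le_rfl
  have hpow : 0 ≤ (1 - lam) ^ k * I.increment := by positivity
  have hfar : 1 ≤ (k + 2) * s ^ 2 * (x - y) := by
    push_cast at hfind
    have e1 := mul_le_mul_of_nonneg_left hfind.le hs0.le
    have e2 : 1 ≤ (P - y * s) * ((k + 1) * s + I.q) := by
      have : P * I.q - I.p * s = 1 := by rw [hs, hP]; linear_combination hdet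
      nlinarith
    have e3 : (P - y * s) ≤ (x - y) * s := by linarith
    have e4 : (k + 1) * s + I.q ≤ (k + 2) * s := by linarith
    calc (1 : ℝ) ≤ (P - y * s) * ((k + 1) * s + I.q) := e2
      _ ≤ ((x - y) * s) * ((k + 2) * s) := by
        apply mul_le_mul e3 e4 (by positivity) (by positivity)
      _ = _ := by ring
  calc I.mediantValue lam - denjoyTichyUitz lam y ≤ (1 - lam) ^ k * lam * I.increment := by
        rw [← e6]; linarith
    _ ≤ (1 - lam) ^ k * I.increment := by
        have : (1 - lam) ^ k * I.increment * lam ≤ (1 - lam) ^ k * I.increment :=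
          mul_le_of_le_one_right hpow h1.le
        linarith
    _ ≤ _ := le_mul_of_one_le_right hpow hfar

theorem density_nonneg {I : FareyInterval} (h : I.Around x) : 0 ≤ I.density :=
  mul_nonneg h.increment_pos.le (sq_nonneg _)

theorem denjoy_sub_le_right (h0 : 0 < lam) (h1 : lam < 1) (hx0 : 0 ≤ x) (hx1 : x < 1) {C : ℝ}
    (hC : ∀ k : ℕ, lam ^ k * (k + 2) ≤ C) {n : ℕ}
    (hn : x < (descent lam x n).mediant) (hnext : ∃ m, n < m ∧ x < (descent lam x m).mediant)
    (hy : (descent lam x n).Contains y) (hmy : (descent lam x n).mediant ≤ y) :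
    ∃ m, n < m ∧ denjoyTichyUitz lam y - denjoyTichyUitz lam x ≤
      (C * (descent lam x n).density + (descent lam x m).density) * (y - x) := by
  obtain ⟨k, hk⟩ := denjoy_right_of_mediant h0 h1 hx0 hx1 hn hy hmy
  obtain ⟨m, hnm, hm, er, es, eg, -⟩ := exists_next_left hn hnext
  refine ⟨m, hnm, ?_⟩
  have ha := around_descent h0 h1 hx0 hx1 n
  have ham := around_descent h0 h1 hx0 hx1 m
  have hgx := gl_le_denjoy h0 h1 hx0 hx1 m
  have hdetm := ham.det_real
  have hμ := ha.increment_pos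
  have hμm := ham.increment_pos
  rw [lt_mediant_iff ham] at hm
  rw [← not_lt, lt_mediant_iff ha, not_lt] at hmy
  rw [lt_mediant_iff ha] at hn
  have hq1 : (1 : ℝ) ≤ (descent lam x n).q := by exact_mod_cast ha.q_pos
  have hs1 : (1 : ℝ) ≤ (descent lam x n).s := by exact_mod_cast ha.s_pos
  have hqm : (0 : ℝ) ≤ (descent lam x m).q := Nat.cast_nonneg _
  have hr : ((descent lam x m).r : ℝ) = (descent lam x n).p + (descent lam x n).r := by
    rw [er]; push_cast; rfl
  have hs : ((descent lam x m).s : ℝ) = (descent lam x n).q + (descent lam x n).s := by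
    rw [es]; push_cast; rfl
  rw [← hr, ← hs] at hmy hn
  rw [← hs] at hk
  have hinc : (descent lam x m).increment =
      (descent lam x n).mediantValue lam - (descent lam x m).gl := by rw [increment, eg]
  have hdens : (descent lam x n).density =
      (descent lam x n).increment * (descent lam x m).s ^ 2 := by rw [density, hs]
  have hs0 : (0 : ℝ) < (descent lam x m).s := by linarith
  have hyx : 0 < y - x := by
    have : 0 < (y - x) * (descent lam x m).s := by linarith
    exact pos_of_mul_pos_left this hs0.le
  set J := descent lam x m
  set I := descent lam x n
  have hfar : 1 ≤ ((J.q : ℝ) + J.s) ^ 2 * (y - x) := by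
    have e1 := mul_le_mul_of_nonneg_right hmy (show (0 : ℝ) ≤ J.q + J.s by positivity)
    have e2 := mul_le_mul_of_nonneg_right hm.le hs0.le
    have e3 : 1 ≤ (y - x) * (J.s * ((J.q : ℝ) + J.s)) := by nlinarith
    have e4 : (J.s : ℝ) * ((J.q : ℝ) + J.s) ≤ (J.q + J.s) * (J.q + J.s) := by
      gcongr; linarith
    have e5 := mul_le_mul_of_nonneg_left e4 hyx.le
    nlinarith
  have e1 : J.increment ≤ J.density * (y - x) := by
    rw [density, mul_assoc]
    exact le_mul_of_one_le_right hμm.le hfar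
  have e2 : lam ^ k * I.increment * ((k + 2) * (J.s : ℝ) ^ 2 * (y - x)) ≤
      C * I.density * (y - x) := by
    rw [hdens]
    have := mul_le_mul_of_nonneg_right (hC k)
      (show 0 ≤ I.increment * (J.s : ℝ) ^ 2 * (y - x) by positivity)
    linarith
  linarith

theorem denjoy_sub_le_left (h0 : 0 < lam) (h1 : lam < 1) (hx0 : 0 ≤ x) (hx1 : x < 1) {C : ℝ}
    (hC : ∀ k : ℕ, (1 - lam) ^ k * (k + 2) ≤ C) {n : ℕ}
    (hn : (descent lam x n).mediant ≤ x) (hnext : ∃ m, n < m ∧ (descent lam x m).mediant ≤ x)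
    (hy : (descent lam x n).Contains y) (hmy : y < (descent lam x n).mediant) :
    ∃ m, n < m ∧ denjoyTichyUitz lam x - denjoyTichyUitz lam y ≤
      (C * (descent lam x n).density + (descent lam x m).density) * (x - y) := by
  obtain ⟨k, hk⟩ := denjoy_left_of_mediant h0 h1 hx0 hx1 hn hy hmy
  obtain ⟨m, hnm, hm, er, es, eg, -⟩ := exists_next_right hn hnext
  refine ⟨m, hnm, ?_⟩
  have ha := around_descent h0 h1 hx0 hx1 n
  have ham := around_descent h0 h1 hx0 hx1 m
  have hgx := denjoy_le_gr h0 h1 hx0 hx1 m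
  have hdetm := ham.det_real
  have hμ := ha.increment_pos
  have hμm := ham.increment_pos
  rw [← not_lt, lt_mediant_iff ham, not_lt] at hm
  rw [lt_mediant_iff ha] at hmy
  rw [← not_lt, lt_mediant_iff ha, not_lt] at hn
  have hq1 : (1 : ℝ) ≤ (descent lam x n).q := by exact_mod_cast ha.q_pos
  have hs1 : (1 : ℝ) ≤ (descent lam x n).s := by exact_mod_cast ha.s_pos
  have hsm : (0 : ℝ) ≤ (descent lam x m).s := Nat.cast_nonneg _
  have hr : ((descent lam x m).p : ℝ) = (descent lam x n).p + (descent lam x n).r := by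
    rw [er]; push_cast; rfl
  have hs : ((descent lam x m).q : ℝ) = (descent lam x n).q + (descent lam x n).s := by
    rw [es]; push_cast; rfl
  rw [← hr, ← hs] at hmy hn
  rw [← hs] at hk
  have hinc : (descent lam x m).increment =
      (descent lam x m).gr - (descent lam x n).mediantValue lam := by rw [increment, eg]
  have hdens : (descent lam x n).density =
      (descent lam x n).increment * (descent lam x m).q ^ 2 := by rw [density, hs]
  have hs0 : (0 : ℝ) < (descent lam x m).q := by linarith
  have hyx : 0 < x - y := by
    have : 0 < (x - y) * (descent lam x m).q := by linarith
    exact pos_of_mul_pos_left this hs0.le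
  set J := descent lam x m
  set I := descent lam x n
  have hfar : 1 ≤ ((J.q : ℝ) + J.s) ^ 2 * (x - y) := by
    have e1 := mul_le_mul_of_nonneg_right hmy.le (show (0 : ℝ) ≤ J.q + J.s by positivity)
    have e2 := mul_le_mul_of_nonneg_right hm hs0.le
    have e3 : 1 ≤ (x - y) * (J.q * ((J.q : ℝ) + J.s)) := by nlinarith
    have e4 : (J.q : ℝ) * ((J.q : ℝ) + J.s) ≤ (J.q + J.s) * (J.q + J.s) := by
      gcongr; linarith
    have e5 := mul_le_mul_of_nonneg_left e4 hyx.le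
    nlinarith
  have e1 : J.increment ≤ J.density * (x - y) := by
    rw [density, mul_assoc]
    exact le_mul_of_one_le_right hμm.le hfar
  have e2 : (1 - lam) ^ k * I.increment * ((k + 2) * (J.q : ℝ) ^ 2 * (x - y)) ≤
      C * I.density * (x - y) := by
    rw [hdens]
    have := mul_le_mul_of_nonneg_right (hC k)
      (show 0 ≤ I.increment * (J.q : ℝ) ^ 2 * (x - y) by positivity)
    linarith
  linarith

end FareyInterval

/-! ### Criteria for the derivative -/

namespace FareyInterval

variable {lam x y : ℝ}

theorem le_q_add_s (h0 : 0 < lam) (h1 : lam < 1) (hx0 : 0 ≤ x) (hx1 : x < 1) (n : ℕ) :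
    n + 2 ≤ (descent lam x n).q + (descent lam x n).s := by
  induction n with
  | zero => simp [descent, start]
  | succ n ih =>
    have ha := around_descent h0 h1 hx0 hx1 n
    have := ha.q_pos
    have := ha.s_pos
    rcases lt_or_ge x (descent lam x n).mediant with h | h
    · rw [descent_of_lt h]; simp only; omega
    · rw [descent_of_le h]; simp only; omega

theorem mul_abs_sub_le (h0 : 0 < lam) (h1 : lam < 1) (hx0 : 0 ≤ x) (hx1 : x < 1) {n : ℕ}
    (hy : (descent lam x n).Contains y) :
    ((descent lam x n).q * (descent lam x n).s : ℝ) * |y - x| ≤ 1 := by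
  have ha := around_descent h0 h1 hx0 hx1 n
  have hd := ha.det_real
  obtain ⟨hy1, hy2⟩ := hy
  have hx1 := ha.left_le
  have hx2 := ha.lt_right
  have hq : (0 : ℝ) ≤ (descent lam x n).q := Nat.cast_nonneg _
  have hs : (0 : ℝ) ≤ (descent lam x n).s := Nat.cast_nonneg _
  have e1 := mul_le_mul_of_nonneg_left hy1 hs
  have e2 := mul_le_mul_of_nonneg_left hx1 hs
  have e3 := mul_le_mul_of_nonneg_left hy2.le hq
  have e4 := mul_le_mul_of_nonneg_left hx2.le hq
  rcases abs_cases (y - x) with ⟨h, -⟩ | ⟨h, -⟩ <;> rw [h] <;> linarith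

/-- Points close to the irrational number `x` are separated from `x` by the mediant of a small
Farey interval around `x`. -/
theorem exists_separation (h0 : 0 < lam) (h1 : lam < 1) (hx0 : 0 ≤ x) (hx1 : x < 1)
    (hx : Irrational x) (N : ℕ) :
    ∃ δ > 0, ∀ y, y ≠ x → |y - x| < δ → ∃ n ≥ N, (descent lam x n).Contains y ∧
      ((x < (descent lam x n).mediant ∧ (descent lam x n).mediant ≤ y) ∨
        ((descent lam x n).mediant ≤ x ∧ y < (descent lam x n).mediant)) := by
  have ha := around_descent h0 h1 hx0 hx1 N
  have hq : (0 : ℝ) < (descent lam x N).q := by exact_mod_cast ha.q_pos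
  have hs : (0 : ℝ) < (descent lam x N).s := by exact_mod_cast ha.s_pos
  have hleft : ((descent lam x N).p : ℝ) / (descent lam x N).q < x := by
    refine lt_of_le_of_ne ((div_le_iff₀ hq).2 ha.left_le) fun h => ?_
    exact hx ⟨((descent lam x N).p : ℚ) / (descent lam x N).q, by push_cast; exact h⟩
  have hright : x < ((descent lam x N).r : ℝ) / (descent lam x N).s :=
    (lt_div_iff₀ hs).2 ha.lt_right
  obtain ⟨δ, hδ, hball⟩ := Metric.isOpen_iff.1
    (isOpen_Ioo (a := ((descent lam x N).p : ℝ) / (descent lam x N).q)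
      (b := ((descent lam x N).r : ℝ) / (descent lam x N).s)) x ⟨hleft, hright⟩
  refine ⟨δ, hδ, fun y hne hy => ?_⟩
  have hmem := hball (show y ∈ Metric.ball x δ by rwa [Metric.mem_ball, Real.dist_eq])
  have hcN : (descent lam x N).Contains y :=
    ⟨((div_lt_iff₀ hq).1 hmem.1).le, (lt_div_iff₀ hs).1 hmem.2⟩
  have hex : ∃ k, ¬ (descent lam x (N + k)).Contains y := by
    by_contra! hall
    obtain ⟨k, hk⟩ := exists_nat_gt (1 / |y - x|)
    have hpos : 0 < |y - x| := abs_pos.2 (sub_ne_zero.2 hne)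
    rw [div_lt_iff₀ hpos] at hk
    have e1 := mul_abs_sub_le h0 h1 hx0 hx1 (hall k)
    have e2 := le_q_add_s h0 h1 hx0 hx1 (N + k)
    have ha := around_descent h0 h1 hx0 hx1 (N + k)
    have e3 : k ≤ (descent lam x (N + k)).q * (descent lam x (N + k)).s := by
      have := ha.q_pos
      have := ha.s_pos
      nlinarith
    have e4 : (k : ℝ) ≤ (descent lam x (N + k)).q * (descent lam x (N + k)).s := by
      exact_mod_cast e3
    have := mul_le_mul_of_nonneg_right e4 hpos.le
    linarith
  classical
  have hfind := Nat.find_spec hex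
  have hne0 : Nat.find hex ≠ 0 := fun h => by rw [h] at hfind; exact hfind hcN
  obtain ⟨k, hk⟩ := Nat.exists_eq_succ_of_ne_zero hne0
  have hck : (descent lam x (N + k)).Contains y :=
    not_not.1 (Nat.find_min hex (by omega : k < Nat.find hex))
  rw [hk, Nat.succ_eq_add_one, ← add_assoc] at hfind
  have ha := around_descent h0 h1 hx0 hx1 (N + k)
  refine ⟨N + k, Nat.le_add_right _ _, hck, ?_⟩
  rcases lt_or_ge x (descent lam x (N + k)).mediant with h | h
  · left
    refine ⟨h, ?_⟩
    by_contra! hlt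
    rw [lt_mediant_iff ha] at hlt
    rw [descent_of_lt h] at hfind
    exact hfind ⟨hck.1, by push_cast; exact hlt⟩
  · right
    refine ⟨h, ?_⟩
    by_contra! hle
    rw [← not_lt, lt_mediant_iff ha, not_lt] at hle
    rw [descent_of_le h] at hfind
    exact hfind ⟨by push_cast; exact hle, hck.2⟩

theorem exists_pow_mul_le (h0 : 0 < lam) (h1 : lam < 1) :
    ∃ C : ℝ, 0 < C ∧ ∀ k : ℕ, lam ^ k * (k + 2) ≤ C := by
  have h : Tendsto (fun k : ℕ => (k : ℝ) * lam ^ k) atTop (𝓝 0) :=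
    tendsto_self_mul_const_pow_of_lt_one h0.le h1
  obtain ⟨B, hB⟩ := h.bddAbove_range
  refine ⟨|B| + 2, by positivity, fun k => ?_⟩
  have h2 : (k : ℝ) * lam ^ k ≤ B := hB ⟨k, rfl⟩
  have h3 : lam ^ k ≤ 1 := pow_le_one₀ h0.le h1.le
  have := le_abs_self B
  linarith

/-- If the densities of the Farey intervals around `x` tend to zero, so do the difference
quotients. -/
theorem hasDerivAt_zero (h0 : 0 < lam) (h1 : lam < 1) (hx0 : 0 ≤ x) (hx1 : x < 1)
    (hx : Irrational x) (hL : ∀ n, ∃ m, n < m ∧ x < (descent lam x m).mediant)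
    (hR : ∀ n, ∃ m, n < m ∧ (descent lam x m).mediant ≤ x)
    (hd : Tendsto (fun n => (descent lam x n).density) atTop (𝓝 0)) :
    HasDerivAt (denjoyTichyUitz lam) 0 x := by
  obtain ⟨C₁, hC₁0, hC₁⟩ := exists_pow_mul_le h0 h1
  obtain ⟨C₂, hC₂0, hC₂⟩ := exists_pow_mul_le (sub_pos.2 h1) (show 1 - lam < 1 by linarith)
  rw [hasDerivAt_iff_isLittleO, Asymptotics.isLittleO_iff]
  intro ε hε
  set η := ε / (C₁ + C₂ + 1) with hη
  have hη0 : 0 < η := by positivity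
  obtain ⟨N, hN⟩ := eventually_atTop.1 (hd.eventually_lt_const hη0)
  obtain ⟨δ, hδ, hsep⟩ := exists_separation h0 h1 hx0 hx1 hx N
  filter_upwards [Metric.ball_mem_nhds x hδ] with y hy
  rw [Metric.mem_ball, Real.dist_eq] at hy
  simp only [smul_zero, sub_zero, Real.norm_eq_abs]
  rcases eq_or_ne y x with rfl | hne
  · simp
  obtain ⟨n, hn, hc, h⟩ := hsep y hne hy
  have hbound : ∀ C m, 0 < C → C ≤ C₁ + C₂ → n < m → ∀ d, 0 ≤ d →
      (C * (descent lam x n).density + (descent lam x m).density) * d ≤ ε * d := by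
    intro C m hC0 hC hm d hd
    refine mul_le_mul_of_nonneg_right ?_ hd
    have e1 := mul_le_mul_of_nonneg_left (hN n hn).le hC0.le
    have e2 := (hN m (by omega)).le
    have e3 := mul_le_mul_of_nonneg_right hC hη0.le
    have e4 : (C₁ + C₂ + 1) * η = ε := by rw [hη]; field_simp
    linarith
  obtain ⟨hy0, hy1⟩ := unit_of_contains h0 h1 hx0 hx1 hc
  -- on either side the function is monotone across the mediant
  rcases h with ⟨hxm, hmy⟩ | ⟨hmx, hym⟩
  · obtain ⟨m, hm, hle⟩ := denjoy_sub_le_right h0 h1 hx0 hx1 hC₁ hxm (hL n) hc hmy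
    have hmono : denjoyTichyUitz lam x ≤ denjoyTichyUitz lam y := by
      have e1 := denjoy_le_gr h0 h1 hx0 hx1 (n + 1)
      have e2 := gl_le_denjoy h0 h1 hy0 hy1 (n + 1)
      have hdy := descent_eq_of_contains h0 h1 hx0 hx1 hc
      rw [descent_of_lt hxm] at e1
      rw [descent_of_le (by rw [hdy]; exact hmy), hdy] at e2
      exact e1.trans e2
    rw [abs_of_nonneg (sub_nonneg.2 hmono), abs_of_nonneg (by linarith : 0 ≤ y - x)]
    exact hle.trans (hbound C₁ m hC₁0 (by linarith) hm _ (by linarith))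
  · obtain ⟨m, hm, hle⟩ := denjoy_sub_le_left h0 h1 hx0 hx1 hC₂ hmx (hR n) hc hym
    have hmono : denjoyTichyUitz lam y ≤ denjoyTichyUitz lam x := by
      have e1 := gl_le_denjoy h0 h1 hx0 hx1 (n + 1)
      have e2 := denjoy_le_gr h0 h1 hy0 hy1 (n + 1)
      have hdy := descent_eq_of_contains h0 h1 hx0 hx1 hc
      rw [descent_of_le hmx] at e1
      rw [descent_of_lt (by rw [hdy]; exact hym), hdy] at e2
      exact e2.trans e1
    rw [abs_sub_comm, abs_sub_comm y x, abs_of_nonneg (sub_nonneg.2 hmono),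
      abs_of_nonneg (by linarith : 0 ≤ x - y)]
    exact hle.trans (hbound C₂ m hC₂0 (by linarith) hm _ (by linarith))

theorem increment_ge (h0 : 0 < lam) (h1 : lam < 1) (hx0 : 0 ≤ x) (hx1 : x < 1) (n k : ℕ) :
    (lam * (1 - lam)) ^ k * (descent lam x n).increment ≤ (descent lam x (n + k)).increment := by
  induction k with
  | zero => simp
  | succ k ih =>
    have hμ := (around_descent h0 h1 hx0 hx1 (n + k)).increment_pos
    have hstep : lam * (1 - lam) * (descent lam x (n + k)).increment ≤
        (descent lam x (n + k + 1)).increment := by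
      rcases lt_or_ge x (descent lam x (n + k)).mediant with h | h
      · rw [descent_of_lt h]
        have : 0 ≤ lam * lam * (descent lam x (n + k)).increment := by positivity
        simp only [increment, mediantValue] at this ⊢
        linarith
      · rw [descent_of_le h]
        have : 0 ≤ (1 - lam) * (1 - lam) * (descent lam x (n + k)).increment :=
          mul_nonneg (mul_self_nonneg _) hμ.le
        simp only [increment, mediantValue] at this ⊢
        linarith
    have hc : 0 ≤ lam * (1 - lam) := mul_nonneg h0.le (sub_nonneg.2 h1.le)
    rw [pow_succ', mul_assoc, ← add_assoc]
    exact (mul_le_mul_of_nonneg_left ih hc).trans hstep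

/-- If the descent of `x` turns in both directions with bounded gaps, the difference quotient across
a mediant is at least of the order of the quotient of the increment by the length of the
interval. -/
theorem hasDerivAtTop (h0 : 0 < lam) (h1 : lam < 1) (hx0 : 0 ≤ x) (hx1 : x < 1)
    (hx : Irrational x) {G N : ℕ}
    (hL : ∀ n ≥ N, ∃ m, n < m ∧ m ≤ n + G ∧ x < (descent lam x m).mediant)
    (hR : ∀ n ≥ N, ∃ m, n < m ∧ m ≤ n + G ∧ (descent lam x m).mediant ≤ x)
    (hd : Tendsto (fun n => (descent lam x n).increment *
      ((descent lam x n).q * (descent lam x n).s : ℝ)) atTop atTop) :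
    HasDerivAtTop (denjoyTichyUitz lam) x := by
  set c := lam * (1 - lam) with hc
  have h1' : 0 < 1 - lam := sub_pos.2 h1
  have hc0 : 0 < c := mul_pos h0 h1'
  have hc1 : c ≤ 1 := by nlinarith
  have hcl : c ≤ lam := mul_le_of_le_one_right h0.le (by linarith)
  have hcr : c ≤ 1 - lam := mul_le_of_le_one_left h1'.le h1.le
  rw [HasDerivAtTop, tendsto_atTop]
  intro A
  obtain ⟨N', hN'⟩ := eventually_atTop.1 (hd.eventually_ge_atTop (|A| / c ^ (G + 1)))
  obtain ⟨δ, hδ, hsep⟩ := exists_separation h0 h1 hx0 hx1 hx (max N N')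
  rw [eventually_nhdsWithin_iff]
  filter_upwards [Metric.ball_mem_nhds (0 : ℝ) hδ] with h hh hne
  rw [Metric.mem_ball, dist_zero_right, Real.norm_eq_abs] at hh
  have hne : h ≠ 0 := hne
  obtain ⟨n, hn, hcy, hcase⟩ := hsep (x + h) (by simpa using hne) (by simpa using hh)
  have hnN : n ≥ N := le_trans (le_max_left _ _) hn
  have hnN' : n ≥ N' := le_trans (le_max_right _ _) hn
  obtain ⟨hy0, hy1⟩ := unit_of_contains h0 h1 hx0 hx1 hcy
  have hlen := mul_abs_sub_le h0 h1 hx0 hx1 hcy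
  rw [add_sub_cancel_left] at hlen
  have hdy := descent_eq_of_contains h0 h1 hx0 hx1 hcy
  have ha := around_descent h0 h1 hx0 hx1 n
  have hμ := ha.increment_pos
  have hbig := hN' n hnN'
  rw [div_le_iff₀ (by positivity)] at hbig
  have hgrow : ∀ m, n < m → m ≤ n + G →
      c ^ G * (descent lam x n).increment ≤ (descent lam x m).increment := by
    intro m hm1 hm2
    obtain ⟨k, rfl⟩ := Nat.exists_eq_add_of_lt hm1
    refine le_trans ?_ (increment_ge h0 h1 hx0 hx1 n (k + 1))
    exact mul_le_mul_of_nonneg_right (pow_le_pow_of_le_one hc0.le hc1 (by omega)) hμ.le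
  have hfinal : ∀ m, n < m → m ≤ n + G → A * |h| ≤ c * (descent lam x m).increment := by
    intro m hm1 hm2
    have hh0 := abs_nonneg h
    calc A * |h| ≤ |A| * |h| := mul_le_mul_of_nonneg_right (le_abs_self A) hh0
      _ ≤ ((descent lam x n).increment * ((descent lam x n).q * (descent lam x n).s : ℝ) *
          c ^ (G + 1)) * |h| := mul_le_mul_of_nonneg_right hbig hh0
      _ = c ^ (G + 1) * (descent lam x n).increment *
          (((descent lam x n).q * (descent lam x n).s : ℝ) * |h|) := by ring
      _ ≤ c ^ (G + 1) * (descent lam x n).increment :=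
        mul_le_of_le_one_right (by positivity) hlen
      _ = c * (c ^ G * (descent lam x n).increment) := by ring
      _ ≤ _ := mul_le_mul_of_nonneg_left (hgrow m hm1 hm2) hc0.le
  rcases hcase with ⟨hxm, hmy⟩ | ⟨hmx, hym⟩
  · have hpos : 0 < h := by linarith
    obtain ⟨m₀, hm₀, hm₀G, hm₀L⟩ := hL n hnN
    obtain ⟨m, hnm, hm, er, es, eg, hmin⟩ := exists_next_left hxm ⟨m₀, hm₀, hm₀L⟩
    have hmG : m ≤ n + G := (hmin m₀ hm₀ hm₀L).trans hm₀G
    rw [le_div_iff₀ hpos]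
    have hf := hfinal m hnm hmG
    rw [abs_of_pos hpos] at hf
    have e1 := denjoy_le_gr h0 h1 hx0 hx1 (m + 1)
    have e2 := gl_le_denjoy h0 h1 hy0 hy1 (n + 1)
    rw [descent_of_lt hm] at e1
    rw [descent_of_le (by rw [hdy]; exact hmy), hdy] at e2
    have e3 := mul_le_mul_of_nonneg_right hcr (around_descent h0 h1 hx0 hx1 m).increment_pos.le
    simp only at e1 e2
    rw [← eg] at e2
    simp only [increment, mediantValue] at e1 e3 hf
    linarith
  · have hneg : h < 0 := by linarith
    obtain ⟨m₀, hm₀, hm₀G, hm₀R⟩ := hR n hnN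
    obtain ⟨m, hnm, hm, er, es, eg, hmin⟩ := exists_next_right hmx ⟨m₀, hm₀, hm₀R⟩
    have hmG : m ≤ n + G := (hmin m₀ hm₀ hm₀R).trans hm₀G
    rw [le_div_iff_of_neg hneg]
    have hf := hfinal m hnm hmG
    rw [abs_of_neg hneg] at hf
    have e1 := gl_le_denjoy h0 h1 hx0 hx1 (m + 1)
    have e2 := denjoy_le_gr h0 h1 hy0 hy1 (n + 1)
    rw [descent_of_le hm] at e1
    rw [descent_of_lt (by rw [hdy]; exact hym), hdy] at e2
    have e3 := mul_le_mul_of_nonneg_right hcl (around_descent h0 h1 hx0 hx1 m).increment_pos.le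
    simp only at e1 e2
    rw [← eg] at e2
    simp only [increment, mediantValue] at e1 e3 hf
    linarith

end FareyInterval

/-! ### Continued fraction expansions -/

/-- `x = [0; a₀, a₁, …]`, and `y n = [0; a_n, a_{n+1}, …]` are the tails of this expansion. -/
structure IsExpansion (x : ℝ) (a : ℕ → ℕ) (y : ℕ → ℝ) : Prop where
  zero : y 0 = x
  pos : ∀ n, 0 < y n
  lt_one : ∀ n, y n < 1
  succ : ∀ n, 1 = (a n + y (n + 1)) * y n

namespace IsExpansion

variable {x : ℝ} {a : ℕ → ℕ} {y : ℕ → ℝ}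

theorem one_le (h : IsExpansion x a y) (n : ℕ) : 1 ≤ a n := by
  by_contra! h0
  have h0 : a n = 0 := by omega
  have h1 := h.succ n
  rw [h0, Nat.cast_zero, zero_add] at h1
  have := mul_lt_one_of_nonneg_of_lt_one_left (h.pos (n + 1)).le (h.lt_one (n + 1)) (h.lt_one n).le
  linarith

theorem inv_eq (h : IsExpansion x a y) (n : ℕ) : (y n)⁻¹ = a n + y (n + 1) :=
  inv_eq_of_mul_eq_one_left (h.succ n).symm

theorem of_get (h : IsExpansion x a y) (k n : ℕ) {v : ℝ} (hv : Int.fract v = y k) :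
    (GenContFract.of v).s.get? n = some ⟨1, a (k + n)⟩ := by
  have hfl : ∀ k, ⌊(a k + y (k + 1) : ℝ)⌋ = a k := fun k => by
    rw [Int.floor_natCast_add, Int.floor_eq_zero_iff.2 ⟨(h.pos _).le, h.lt_one _⟩, add_zero]
  induction n generalizing k v with
  | zero =>
    have := GenContFract.of_s_head (v := v) (by rw [hv]; exact (h.pos k).ne')
    rw [hv, h.inv_eq, hfl] at this
    exact_mod_cast this
  | succ n ih =>
    rw [GenContFract.of_s_succ, hv, h.inv_eq, ih (k + 1), Nat.add_right_comm, add_assoc]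
    rw [Int.fract_natCast_add, Int.fract_eq_self.2 ⟨(h.pos _).le, h.lt_one _⟩]

theorem fract_eq (h : IsExpansion x a y) : Int.fract x = y 0 := by
  rw [h.zero, Int.fract_eq_self, ← h.zero]
  exact ⟨(h.pos _).le, h.lt_one _⟩

theorem partialQuotient_eq (h : IsExpansion x a y) (n : ℕ) : partialQuotient x (n + 1) = a n := by
  rw [partialQuotient, Nat.add_sub_cancel,
    GenContFract.partDen_eq_s_b (h.of_get 0 n h.fract_eq), Option.getD_some, zero_add]

theorem irrational (h : IsExpansion x a y) : Irrational x := by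
  rintro ⟨q, hq⟩
  obtain ⟨n, hn⟩ := (GenContFract.terminates_iff_rat x).2 ⟨q, hq.symm⟩
  rw [Stream'.Seq.TerminatedAt, h.of_get 0 n h.fract_eq] at hn
  exact absurd hn (by simp)

theorem mem_Ioo (h : IsExpansion x a y) : x ∈ Set.Ioo (0 : ℝ) 1 :=
  h.zero ▸ ⟨h.pos 0, h.lt_one 0⟩

end IsExpansion

theorem exists_isExpansion {x : ℝ} (hx : x ∈ Set.Ioo (0 : ℝ) 1) (hirr : Irrational x) :
    ∃ a y, IsExpansion x a y := by
  let y : ℕ → ℝ := fun n => Nat.rec x (fun _ t => Int.fract t⁻¹) n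
  have hy : ∀ n, y (n + 1) = Int.fract (y n)⁻¹ := fun n => rfl
  have key : ∀ n, Irrational (y n) ∧ 0 < y n ∧ y n < 1 := by
    intro n
    induction n with
    | zero => exact ⟨hirr, hx.1, hx.2⟩
    | succ n ih =>
      have hi : Irrational (y (n + 1)) := by
        rw [hy, Int.fract]
        exact ih.1.inv.sub_intCast _
      refine ⟨hi, lt_of_le_of_ne ?_ hi.ne_zero.symm, ?_⟩
      · rw [hy]; exact Int.fract_nonneg _
      · rw [hy]; exact Int.fract_lt_one _
  refine ⟨fun n => ⌊(y n)⁻¹⌋₊, y, rfl, fun n => (key n).2.1, fun n => (key n).2.2, fun n => ?_⟩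
  have h0 := (key n).2.1
  rw [hy, natCast_floor_eq_intCast_floor (inv_nonneg.2 h0.le), Int.floor_add_fract,
    inv_mul_cancel₀ h0.ne']

/-- Every periodic sequence of positive integers is the sequence of partial quotients of a number,
a fixed point of the composition of the maps `t ↦ 1 / (a_i + t)` over one period. -/
theorem exists_isExpansion_of_periodic {m : ℕ} (hm : 0 < m) {a : ℕ → ℕ} (ha : ∀ n, 1 ≤ a n)
    (hper : ∀ n, a (n % m) = a n) : ∃ x y, IsExpansion x a y := by
  let g : ℕ → ℝ → ℝ := fun j t => Nat.rec t (fun j s => ((a (m - 1 - j) : ℝ) + s)⁻¹) j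
  have hg0 : ∀ t, g 0 t = t := fun _ => rfl
  have hg : ∀ j t, g (j + 1) t = ((a (m - 1 - j) : ℝ) + g j t)⁻¹ := fun _ _ => rfl
  have ha' : ∀ n, (1 : ℝ) ≤ a n := fun n => by exact_mod_cast ha n
  have hmaps : ∀ j, ∀ t ∈ Set.Icc (0 : ℝ) 1, g j t ∈ Set.Icc (0 : ℝ) 1 := by
    intro j t ht
    induction j with
    | zero => exact ht
    | succ j ih =>
      rw [hg]
      have h1 := ha' (m - 1 - j)
      exact ⟨inv_nonneg.2 (by linarith [ih.1]), inv_le_one_of_one_le₀ (by linarith [ih.1])⟩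
  have hcont : ∀ j, ContinuousOn (g j) (Set.Icc 0 1) := by
    intro j
    induction j with
    | zero => exact continuousOn_id
    | succ j ih =>
      have h2 : ContinuousOn (fun t => ((a (m - 1 - j) : ℝ) + g j t)⁻¹) (Set.Icc 0 1) := by
        refine (continuousOn_const.add ih).inv₀ fun t ht => ?_
        have h1 := ha' (m - 1 - j)
        have h3 := (hmaps j t ht).1
        exact (by linarith : (0 : ℝ) < a (m - 1 - j) + g j t).ne'
      exact h2
  obtain ⟨t, ht, hfix⟩ := exists_mem_Icc_isFixedPt_of_mapsTo (hcont m) zero_le_one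
    (fun t ht => hmaps m t ht)
  have hfix : g m t = t := hfix
  let y : ℕ → ℝ := fun k => g (m - k % m) t
  have hymem : ∀ k, y k ∈ Set.Icc (0 : ℝ) 1 := fun k => hmaps _ t ht
  have hy : ∀ k, y k = ((a k : ℝ) + y (k + 1))⁻¹ := by
    intro k
    have hlt := Nat.mod_lt k hm
    obtain ⟨j, hj⟩ : ∃ j, m - k % m = j + 1 := ⟨m - k % m - 1, by omega⟩
    have e1 : y k = ((a k : ℝ) + g j t)⁻¹ := by
      show g (m - k % m) t = _
      rw [hj, hg, show m - 1 - j = k % m by omega, hper]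
    have e2 : y (k + 1) = g j t := by
      show g (m - (k + 1) % m) t = _
      rcases Nat.lt_or_ge (k % m + 1) m with h | h
      · rw [Nat.add_mod, Nat.mod_eq_of_lt (lt_of_le_of_lt (Nat.le_add_left 1 (k % m)) h),
          Nat.mod_eq_of_lt h]
        congr 1
        omega
      · have hm1 : k % m + 1 = m := by omega
        have : (k + 1) % m = 0 := by
          rw [← Nat.mod_add_mod, hm1, Nat.mod_self]
        rw [this, Nat.sub_zero, hfix, show j = 0 by omega, hg0]
    rw [e1, e2]
  have hpos : ∀ k, 0 < y k := fun k => by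
    rw [hy]
    have := (hymem (k + 1)).1
    have := ha' k
    positivity
  refine ⟨y 0, y, rfl, hpos, fun k => ?_, fun k => ?_⟩
  · rw [hy]
    exact inv_lt_one_of_one_lt₀ (by linarith [ha' k, hpos (k + 1)])
  · rw [hy k, mul_inv_cancel₀]
    have := hpos (k + 1)
    positivity

/-- The word of the first `t` pairs of a sequence of partial quotients. -/
def prefixWord (a : ℕ → ℕ) (t : ℕ) : List (ℕ × ℕ) :=
  (List.range t).map fun i => (a (2 * i), a (2 * i + 1))

theorem prefixWord_succ (a : ℕ → ℕ) (t : ℕ) :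
    prefixWord a (t + 1) = prefixWord a t ++ [(a (2 * t), a (2 * t + 1))] := by
  simp [prefixWord, List.range_succ]

@[simp] theorem length_prefixWord (a : ℕ → ℕ) (t : ℕ) : (prefixWord a t).length = t := by
  simp [prefixWord]

theorem admissible_prefixWord {a : ℕ → ℕ} (ha : ∀ n, 1 ≤ a n) (t : ℕ) :
    Admissible (prefixWord a t) := by
  intro c hc
  obtain ⟨i, -, rfl⟩ := List.mem_map.1 hc
  exact ⟨ha _, ha _⟩

theorem IsExpansion.weightedSum_eq {x : ℝ} {a : ℕ → ℕ} {y : ℕ → ℝ} (h : IsExpansion x a y)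
    (t : ℕ) : weightedSum x (2 * t) = wordWeight (prefixWord a t) := by
  induction t with
  | zero => simp [weightedSum, prefixWord]
  | succ t ih =>
    have e1 : weightedSum x (2 * (t + 1)) =
        weightedSum x (2 * t) + a (2 * t) + 2 * a (2 * t + 1) := by
      rw [weightedSum, show 2 * (t + 1) = 2 * t + 1 + 1 by ring,
        Finset.sum_Icc_succ_top (by omega), Finset.sum_Icc_succ_top (by omega), ← weightedSum,
        h.partialQuotient_eq, h.partialQuotient_eq]
      have e2 : (-1 : ℝ) ^ (2 * t + 1) = -1 := Odd.neg_one_pow ⟨t, rfl⟩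
      rw [pow_succ (-1 : ℝ) (2 * t + 1), e2]
      ring
    rw [e1, ih, prefixWord_succ, wordWeight_append]
    simp only [wordWeight_cons, wordWeight_nil]
    push_cast
    ring

/-! ### The descent in terms of partial quotients -/

namespace FareyInterval

/-- The `n`-th interval of the descent of `x` has denominators `q`, `s` and increment `μ`, and
`x = (p u + r v) / (q u + s v)`, so that `u : v` are homogeneous coordinates of `x` in the
interval. -/
structure Located (lam x : ℝ) (n q s : ℕ) (μ u v : ℝ) : Prop where
  around : (descent lam x n).Around x
  q_eq : (descent lam x n).q = q
  s_eq : (descent lam x n).s = s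
  increment_eq : (descent lam x n).increment = μ
  u_pos : 0 < u
  v_pos : 0 < v
  coord : x * (q * u + s * v) = (descent lam x n).p * u + (descent lam x n).r * v

variable {lam x μ u v : ℝ} {n q s : ℕ}

theorem Located.lt_mediant_iff (h : Located lam x n q s μ u v) :
    x < (descent lam x n).mediant ↔ v < u := by
  have hd := h.around.det_real
  have hc := h.coord
  have hq : (0 : ℝ) < (descent lam x n).q := by exact_mod_cast h.around.q_pos
  have hs : (0 : ℝ) < (descent lam x n).s := by exact_mod_cast h.around.s_pos
  rw [FareyInterval.lt_mediant_iff h.around]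
  rw [← h.q_eq, ← h.s_eq] at hc
  set I := descent lam x n
  have hu := h.u_pos
  have hv := h.v_pos
  have hD : 0 < (I.q : ℝ) * u + I.s * v := by positivity
  -- the difference of the two fractions is `(u - v) / (q u + s v)`
  have key : ((I.p : ℝ) + I.r - x * (I.q + I.s)) * (I.q * u + I.s * v) = u - v := by
    linear_combination (u - v) * hd - ((I.q : ℝ) + I.s) * hc
  constructor
  · intro hlt
    have := mul_pos (sub_pos.2 hlt) hD
    linarith
  · intro hlt
    have h1 : 0 < ((I.p : ℝ) + I.r - x * (I.q + I.s)) * (I.q * u + I.s * v) := by linarith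
    have := pos_of_mul_pos_left h1 hD.le
    linarith

theorem Located.left (h : Located lam x n q s μ u v) (h0 : 0 < lam) (h1 : lam < 1)
    (huv : v < u) : Located lam x (n + 1) q (s + q) (lam * μ) (u - v) v := by
  have hlt := h.lt_mediant_iff.2 huv
  have hstep := descent_of_lt hlt
  have hc := h.coord
  refine ⟨h.around.step h0 h1, ?_, ?_, ?_, sub_pos.2 huv, h.v_pos, ?_⟩
  · rw [hstep, h.q_eq]
  · rw [hstep, ← h.q_eq, ← h.s_eq]
    exact add_comm _ _
  · rw [hstep, ← h.increment_eq]
    simp only [increment, mediantValue]; ring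
  · rw [hstep]
    push_cast
    linear_combination hc

theorem Located.right (h : Located lam x n q s μ u v) (h0 : 0 < lam) (h1 : lam < 1) (huv : u < v) :
    Located lam x (n + 1) (q + s) s ((1 - lam) * μ) u (v - u) := by
  have hle := not_lt.1 (h.lt_mediant_iff.not.2 huv.le.not_gt)
  have hstep := descent_of_le hle
  have hc := h.coord
  refine ⟨h.around.step h0 h1, ?_, ?_, ?_, h.u_pos, sub_pos.2 huv, ?_⟩
  · rw [hstep, h.q_eq, h.s_eq]
  · rw [hstep, h.s_eq]
  · rw [hstep, ← h.increment_eq]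
    simp only [increment, mediantValue]; ring
  · rw [hstep]
    push_cast
    linear_combination hc

theorem Located.left_run (h : Located lam x n q s μ u v) (h0 : 0 < lam) (h1 : lam < 1) (k : ℕ)
    (hk : k * v < u) : Located lam x (n + k) q (s + k * q) (lam ^ k * μ) (u - k * v) v := by
  induction k with
  | zero => simpa using h
  | succ k ih =>
    push_cast at hk
    have hv := h.v_pos
    have := (ih (by linarith)).left h0 h1 (by linarith)
    rw [← add_assoc]
    convert this using 1
    · ring
    · ring
    · push_cast; ring

theorem Located.right_run (h : Located lam x n q s μ u v) (h0 : 0 < lam) (h1 : lam < 1) (k : ℕ)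
    (hk : k * u < v) :
    Located lam x (n + k) (q + k * s) s ((1 - lam) ^ k * μ) u (v - k * u) := by
  induction k with
  | zero => simpa using h
  | succ k ih =>
    push_cast at hk
    have hu := h.u_pos
    have := (ih (by linarith)).right h0 h1 (by linarith)
    rw [← add_assoc]
    convert this using 1
    · ring
    · ring
    · push_cast; ring

/-- Reading a pair of partial quotients `a`, `b` amounts to `a` turns to the left followed by `b`
turns to the right. -/
theorem Located.pair (h : Located lam x n q s μ u v) (h0 : 0 < lam) (h1 : lam < 1)
    (h2 : 1 - lam = lam ^ 2) {a b : ℕ} {y₁ y₂ : ℝ} (hy₁ : 0 < y₁) (hy₂ : 0 < y₂)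
    (hu : u = (a + y₁) * v) (hv : 1 = (b + y₂) * y₁) :
    (∀ k ≤ a, Located lam x (n + k) q (s + k * q) (lam ^ k * μ) (u - k * v) v) ∧
    (∀ j ≤ b, Located lam x (n + a + j) (q + j * (a * q + s)) (a * q + s)
      (lam ^ (a + 2 * j) * μ) (y₁ * v) (v - j * (y₁ * v))) := by
  have hv0 := h.v_pos
  have hA : ∀ k ≤ a, Located lam x (n + k) q (s + k * q) (lam ^ k * μ) (u - k * v) v := by
    intro k hk
    refine h.left_run h0 h1 k ?_
    have hk' : (k : ℝ) ≤ a := by exact_mod_cast hk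
    rw [hu]
    exact mul_lt_mul_of_pos_right (by linarith) hv0
  refine ⟨hA, fun j hj => ?_⟩
  have hj' : (j : ℝ) ≤ b := by exact_mod_cast hj
  have hB := hA a le_rfl
  rw [show u - a * v = y₁ * v by rw [hu]; ring, add_comm s] at hB
  have := hB.right_run h0 h1 j (by
    have : (j : ℝ) * y₁ < 1 := by
      rw [hv]; exact mul_lt_mul_of_pos_right (by linarith) hy₁
    have := mul_lt_mul_of_pos_right this hv0
    linarith)
  rw [h2, ← pow_mul, ← mul_assoc, ← pow_add, add_comm (2 * j)] at this
  exact this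

end FareyInterval

section

open FareyInterval

/-- The number of insertions of a mediant after which the first `t + 1` pairs of partial quotients
are read. The first partial quotient counts one less, because the descent begins in `[0, 1]`. -/
def descentTime (a : ℕ → ℕ) : ℕ → ℕ
  | 0 => a 0 - 1 + a 1
  | t + 1 => descentTime a t + (a (2 * (t + 1)) + a (2 * (t + 1) + 1))

theorem descentTime_strictMono {a : ℕ → ℕ} (ha : ∀ n, 1 ≤ a n) : StrictMono (descentTime a) :=
  strictMono_nat_of_lt_succ fun t => by
    have := ha (2 * (t + 1))
    rw [descentTime]
    omega

theorem exists_descentTime_le {a : ℕ → ℕ} (ha : ∀ n, 1 ≤ a n) {t₀ n : ℕ}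
    (hn : descentTime a t₀ ≤ n) :
    ∃ t ≥ t₀, descentTime a t ≤ n ∧ n < descentTime a (t + 1) := by
  have hmono := descentTime_strictMono ha
  have hex : ∃ t, n < descentTime a t := ⟨n + 1, (hmono.le_apply (x := n + 1))⟩
  classical
  have hfind := Nat.find_spec hex
  have hgt : t₀ < Nat.find hex := by
    by_contra! hle
    have := hmono.monotone hle
    omega
  obtain ⟨t, ht⟩ := Nat.exists_eq_add_of_lt hgt
  refine ⟨t₀ + t, Nat.le_add_right _ _, ?_, ?_⟩
  · exact not_lt.1 (Nat.find_min hex (by omega))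
  · rw [ht] at hfind; exact hfind

/-- The denominators of the Farey interval after `t` pairs. -/
def denominators (a : ℕ → ℕ) (t : ℕ) : ℕ × ℕ := contFold (1, 0) (prefixWord a t)

theorem denominators_succ (a : ℕ → ℕ) (t : ℕ) :
    denominators a (t + 1) = contStep (denominators a t) (a (2 * t), a (2 * t + 1)) := by
  rw [denominators, prefixWord_succ, contFold_append, contFold_cons, contFold_nil, denominators]

theorem denominators_snd_le {a : ℕ → ℕ} (ha : ∀ n, 1 ≤ a n) (t : ℕ) :
    (denominators a t).2 ≤ (denominators a t).1 :=
  contFold_snd_le (admissible_prefixWord ha t) (by simp)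

/-- The quantity `φ ^ (- S) K ^ 2` after `t` pairs, up to the factor `φ`, is the increment over the
Farey interval times the squared larger denominator. -/
theorem increment_mul_sq (a : ℕ → ℕ) (t : ℕ) :
    Real.goldenRatio⁻¹ ^ wordWeight (prefixWord a t) * ((denominators a t).1 : ℝ) ^ 2 =
      Real.exp (excess (prefixWord a t)) := by
  have hK : (0 : ℝ) < continuant (prefixWord a t) := by exact_mod_cast continuant_pos _
  rw [excess, Real.exp_sub, mul_comm 2, Real.exp_mul, Real.exp_log hK,
    mul_comm (_ : ℝ) (Real.log _), Real.exp_mul, Real.exp_log Real.goldenRatio_pos,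
    Real.rpow_natCast, Real.rpow_two, denominators,
    ← continuant, inv_pow]
  field_simp

theorem inv_goldenRatio_facts : 0 < Real.goldenRatio⁻¹ ∧ Real.goldenRatio⁻¹ < 1 ∧
    1 - Real.goldenRatio⁻¹ = Real.goldenRatio⁻¹ ^ 2 := by
  refine ⟨inv_pos.2 Real.goldenRatio_pos, inv_lt_one_of_one_lt₀ Real.one_lt_goldenRatio, ?_⟩
  rw [Real.inv_goldenRatio]
  linear_combination -Real.goldenConj_sq

namespace IsExpansion

variable {lam x : ℝ} {a : ℕ → ℕ} {y : ℕ → ℝ}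

theorem located (h : IsExpansion x a y) (h0 : 0 < lam) (h1 : lam < 1) (h2 : 1 - lam = lam ^ 2)
    (t : ℕ) : ∃ u v, v = y (2 * (t + 1)) * u ∧
      Located lam x (descentTime a t) (denominators a (t + 1)).1 (denominators a (t + 1)).2
        (lam⁻¹ * lam ^ wordWeight (prefixWord a (t + 1))) u v := by
  induction t with
  | zero =>
    have hx : x = y 0 := h.zero.symm
    have e0 := h.succ 0
    have e1 := h.succ 1
    have hx0 : 0 < x := hx ▸ h.pos 0
    have hx1 : x < 1 := hx ▸ h.lt_one 0
    have ha0 := h.one_le 0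
    simp only [zero_add] at e0 e1
    have hstart : Located lam x 0 1 1 1 (1 - x) x := by
      refine ⟨around_start hx0.le hx1, rfl, rfl, ?_, sub_pos.2 hx1, hx0, ?_⟩
      · simp [descent, start, increment]
      · simp [descent, start]
    have hcast : ((a 0 - 1 : ℕ) : ℝ) = a 0 - 1 := by push_cast [Nat.cast_sub ha0]; rfl
    have := (hstart.pair h0 h1 h2 (a := a 0 - 1) (b := a 1) (h.pos 1) (h.pos 2)
      (by rw [hcast]; rw [← hx] at e0; linarith) e1).2 (a 1) le_rfl
    refine ⟨y 1 * x, x - a 1 * (y 1 * x), ?_, ?_⟩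
    · simp only [zero_add, mul_one]
      linear_combination x * e1
    · have ew : wordWeight (prefixWord a (0 + 1)) = a 0 + 2 * a 1 := by simp [prefixWord]
      have ed : denominators a (0 + 1) = (1 + a 1 * a 0, a 0) := by
        simp [denominators, prefixWord, contStep]
      have ep : lam⁻¹ * lam ^ (a 0 + 2 * a 1) = lam ^ (a 0 - 1 + 2 * a 1) * 1 := by
        obtain ⟨k, hk⟩ := Nat.exists_eq_add_of_le' ha0
        rw [hk, Nat.add_sub_cancel]
        field_simp
        ring
      rw [ew, ed, ep, descentTime]
      simp only [zero_add, mul_one, Nat.sub_add_cancel ha0] at this ⊢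
      exact this
  | succ t ih =>
    obtain ⟨u, v, hv, hl⟩ := ih
    have e0 := h.succ (2 * (t + 1))
    have e1 := h.succ (2 * (t + 1) + 1)
    set y₁ := y (2 * (t + 1) + 1)
    have := (hl.pair h0 h1 h2 (h.pos _) (h.pos (2 * (t + 1) + 1 + 1))
      (by rw [hv]; linear_combination u * e0) e1).2 _ le_rfl
    refine ⟨y₁ * v, v - a (2 * (t + 1) + 1) * (y₁ * v), ?_, ?_⟩
    · rw [show 2 * (t + 1 + 1) = 2 * (t + 1) + 1 + 1 by ring]
      linear_combination v * e1
    · rw [denominators_succ a (t + 1), prefixWord_succ a (t + 1), wordWeight_append]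
      simp only [descentTime, contStep, wordWeight_cons, wordWeight_nil, add_zero]
      rw [← add_assoc, pow_add, mul_comm (lam ^ wordWeight _), mul_left_comm]
      exact this

/-- While the pair number `t + 1` is read, the Farey interval has one of two shapes. -/
theorem phase (h : IsExpansion x a y) (h0 : 0 < lam) (h1 : lam < 1) (h2 : 1 - lam = lam ^ 2)
    {t n : ℕ} (hn : descentTime a t ≤ n) (hn' : n < descentTime a (t + 1)) :
    ∃ q s : ℕ, ∃ μ : ℝ, denominators a (t + 1) = (q, s) ∧
      μ = lam⁻¹ * lam ^ wordWeight (prefixWord a (t + 1)) ∧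
      ((∃ k ≤ a (2 * (t + 1)), ∃ u v, Located lam x n q (s + k * q) (lam ^ k * μ) u v) ∨
      ∃ j ≤ a (2 * (t + 1) + 1), ∃ u v,
        Located lam x n (q + j * (a (2 * (t + 1)) * q + s)) (a (2 * (t + 1)) * q + s)
          (lam ^ (a (2 * (t + 1)) + 2 * j) * μ) u v) := by
  obtain ⟨u, v, hv, hl⟩ := h.located h0 h1 h2 t
  obtain ⟨hA, hB⟩ := hl.pair h0 h1 h2 (h.pos (2 * (t + 1) + 1)) (h.pos (2 * (t + 1) + 1 + 1))
    (by rw [hv]; linear_combination u * h.succ (2 * (t + 1))) (h.succ (2 * (t + 1) + 1))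
  refine ⟨_, _, _, rfl, rfl, ?_⟩
  obtain ⟨k, rfl⟩ := Nat.exists_eq_add_of_le hn
  rw [descentTime] at hn'
  rcases le_total k (a (2 * (t + 1))) with hk | hk
  · exact Or.inl ⟨k, hk, _, _, hA k hk⟩
  · obtain ⟨j, rfl⟩ := Nat.exists_eq_add_of_le hk
    rw [← add_assoc]
    exact Or.inr ⟨j, by omega, _, _, hB j (by omega)⟩

theorem left_at (h : IsExpansion x a y) (h0 : 0 < lam) (h1 : lam < 1) (h2 : 1 - lam = lam ^ 2)
    (t : ℕ) : x < (descent lam x (descentTime a t)).mediant := by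
  obtain ⟨u, v, hv, hl⟩ := h.located h0 h1 h2 t
  rw [hl.lt_mediant_iff, hv]
  exact mul_lt_of_lt_one_left hl.u_pos (h.lt_one _)

theorem right_at (h : IsExpansion x a y) (h0 : 0 < lam) (h1 : lam < 1) (h2 : 1 - lam = lam ^ 2)
    (t : ℕ) : (descent lam x (descentTime a t + a (2 * (t + 1)))).mediant ≤ x := by
  obtain ⟨u, v, hv, hl⟩ := h.located h0 h1 h2 t
  have := (hl.pair h0 h1 h2 (h.pos (2 * (t + 1) + 1)) (h.pos (2 * (t + 1) + 1 + 1))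
    (by rw [hv]; linear_combination u * h.succ (2 * (t + 1))) (h.succ (2 * (t + 1) + 1))).2 0
    (Nat.zero_le _)
  rw [add_zero] at this
  rw [← not_lt, this.lt_mediant_iff, not_lt, Nat.cast_zero, zero_mul, sub_zero]
  exact mul_le_of_le_one_left hl.v_pos.le (h.lt_one _).le

/-- If the excess of the prefixes tends to `-∞`, the derivative is zero. -/
theorem hasDerivAt_zero (h : IsExpansion x a y)
    (he : Tendsto (fun t => excess (prefixWord a t)) atTop atBot) :
    HasDerivAt (denjoyTichyUitz Real.goldenRatio⁻¹) 0 x := by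
  obtain ⟨h0, h1, h2⟩ := inv_goldenRatio_facts
  set lam := Real.goldenRatio⁻¹ with hlam
  have ha := h.one_le
  obtain ⟨hx0, hx1⟩ := h.mem_Ioo
  have hmono := descentTime_strictMono ha
  refine FareyInterval.hasDerivAt_zero h0 h1 hx0.le hx1 h.irrational
    (fun n => ⟨_, hmono.le_apply (x := n + 1), h.left_at h0 h1 h2 (n + 1)⟩)
    (fun n => ⟨_, lt_of_lt_of_le (hmono.le_apply (x := n + 1)) (Nat.le_add_right _ _),
      h.right_at h0 h1 h2 (n + 1)⟩) ?_
  -- `λ ^ k (k + 2) ^ 2` is bounded, so a long run does not increase the density by much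
  have hsq : Real.sqrt lam ^ 2 = lam := Real.sq_sqrt h0.le
  obtain ⟨C, hC0, hC⟩ := exists_pow_mul_le (Real.sqrt_pos.2 h0)
    ((Real.sqrt_lt' one_pos).2 (by simpa using h1))
  have hC' : ∀ k : ℕ, lam ^ k * ((k : ℝ) + 2) ^ 2 ≤ C ^ 2 := fun k => by
    have : lam ^ k * ((k : ℝ) + 2) ^ 2 = (Real.sqrt lam ^ k * (k + 2)) ^ 2 := by
      rw [mul_pow, ← pow_mul, mul_comm k, pow_mul, hsq]
    rw [this]
    have := hC k
    gcongr
  have hC1 : 1 ≤ C ^ 2 := by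
    have := hC' 0
    norm_num at this
    linarith
  have hbound : ∀ t n, descentTime a t ≤ n → n < descentTime a (t + 1) →
      (descent lam x n).density ≤
        (C ^ 2) ^ 2 * (lam⁻¹ * Real.exp (excess (prefixWord a (t + 1)))) := by
    intro t n hn hn'
    obtain ⟨q, s, μ, hqs, hμ, hph⟩ := h.phase h0 h1 h2 hn hn'
    have hsq' : s ≤ q := by
      have := denominators_snd_le ha (t + 1)
      rwa [hqs] at this
    have hsr : (s : ℝ) ≤ q := by exact_mod_cast hsq'
    have hμ0 : 0 < μ := by rw [hμ]; positivity
    have hE : μ * (q : ℝ) ^ 2 = lam⁻¹ * Real.exp (excess (prefixWord a (t + 1))) := by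
      rw [← increment_mul_sq, hqs, hμ, ← hlam]; ring
    rw [← hE]
    have hX : 0 ≤ μ * (q : ℝ) ^ 2 := by positivity
    rcases hph with ⟨k, hk, u, v, hl⟩ | ⟨j, hj, u, v, hl⟩
    · rw [density, hl.increment_eq, hl.q_eq, hl.s_eq]
      have e1 : ((q : ℝ) + (s + k * q : ℕ)) ≤ (k + 2) * q := by push_cast; linarith
      calc lam ^ k * μ * ((q : ℝ) + (s + k * q : ℕ)) ^ 2 ≤ lam ^ k * μ * ((k + 2) * q) ^ 2 := by
            gcongr
        _ = (lam ^ k * ((k : ℝ) + 2) ^ 2) * (μ * q ^ 2) := by ring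
        _ ≤ C ^ 2 * (μ * q ^ 2) := mul_le_mul_of_nonneg_right (hC' k) hX
        _ ≤ (C ^ 2) ^ 2 * (μ * q ^ 2) :=
            mul_le_mul_of_nonneg_right (le_self_pow₀ hC1 two_ne_zero) hX
    · rw [density, hl.increment_eq, hl.q_eq, hl.s_eq]
      set b := a (2 * (t + 1))
      have hq0 : (0 : ℝ) ≤ q := Nat.cast_nonneg _
      have e1 : ((q + j * (b * q + s) : ℕ) : ℝ) + (b * q + s : ℕ) ≤ (j + 2) * ((b + 2) * q) := by
        push_cast
        have : (j : ℝ) * s ≤ j * q := by gcongr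
        have : 0 ≤ (j : ℝ) * q := by positivity
        have : 0 ≤ (b : ℝ) * q := by positivity
        nlinarith
      calc lam ^ (b + 2 * j) * μ *
            (((q + j * (b * q + s) : ℕ) : ℝ) + (b * q + s : ℕ)) ^ 2
          ≤ lam ^ (b + 2 * j) * μ * ((j + 2) * ((b + 2) * q)) ^ 2 := by gcongr
        _ = (lam ^ b * ((b : ℝ) + 2) ^ 2) * (lam ^ j * (lam ^ j * ((j : ℝ) + 2) ^ 2)) *
            (μ * q ^ 2) := by ring
        _ ≤ C ^ 2 * (1 * C ^ 2) * (μ * q ^ 2) := by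
            gcongr
            · exact hC' b
            · exact pow_le_one₀ h0.le h1.le
            · exact hC' j
        _ = _ := by ring
  have hlim : Tendsto (fun t => (C ^ 2) ^ 2 * (lam⁻¹ * Real.exp (excess (prefixWord a (t + 1)))))
      atTop (𝓝 0) := by
    have := ((Real.tendsto_exp_atBot.comp (he.comp (tendsto_add_atTop_nat 1))).const_mul
      lam⁻¹).const_mul ((C ^ 2) ^ 2)
    simpa using this
  rw [Metric.tendsto_atTop]
  intro ε hε
  obtain ⟨t₀, ht₀⟩ := eventually_atTop.1 (hlim.eventually_lt_const hε)
  refine ⟨descentTime a t₀, fun n hn => ?_⟩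
  obtain ⟨t, ht, hn1, hn2⟩ := exists_descentTime_le ha hn
  rw [Real.dist_eq, sub_zero,
    abs_of_nonneg (density_nonneg (around_descent h0 h1 hx0.le hx1 n))]
  exact (hbound t n hn1 hn2).trans_lt (ht₀ t ht)

/-- If the partial quotients are bounded and the excess of the prefixes tends to `+∞`, so does the
difference quotient. -/
theorem hasDerivAtTop (h : IsExpansion x a y) {B : ℕ} (hB : ∀ n, a n ≤ B)
    (he : Tendsto (fun t => excess (prefixWord a t)) atTop atTop) :
    HasDerivAtTop (denjoyTichyUitz Real.goldenRatio⁻¹) x := by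
  obtain ⟨h0, h1, h2⟩ := inv_goldenRatio_facts
  set lam := Real.goldenRatio⁻¹ with hlam
  have ha := h.one_le
  obtain ⟨hx0, hx1⟩ := h.mem_Ioo
  have hmono := descentTime_strictMono ha
  have hgap : ∀ t, descentTime a (t + 1) ≤ descentTime a t + 2 * B := fun t => by
    have := hB (2 * (t + 1))
    have := hB (2 * (t + 1) + 1)
    rw [descentTime]; omega
  refine FareyInterval.hasDerivAtTop (G := 3 * B) (N := descentTime a 0) h0 h1 hx0.le hx1
    h.irrational ?_ ?_ ?_
  · intro n hn
    obtain ⟨t, -, hn1, hn2⟩ := exists_descentTime_le ha hn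
    have := hgap t
    exact ⟨_, hn2, by omega, h.left_at h0 h1 h2 (t + 1)⟩
  · intro n hn
    obtain ⟨t, -, hn1, hn2⟩ := exists_descentTime_le ha hn
    have := hgap t
    have := hB (2 * (t + 1 + 1))
    exact ⟨_, lt_of_lt_of_le hn2 (Nat.le_add_right _ _), by omega, h.right_at h0 h1 h2 (t + 1)⟩
  have hbound : ∀ t n, descentTime a t ≤ n → n < descentTime a (t + 1) →
      lam ^ (3 * B) / (B + 1) * (lam⁻¹ * Real.exp (excess (prefixWord a (t + 1)))) ≤
        (descent lam x n).increment * ((descent lam x n).q * (descent lam x n).s : ℝ) := by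
    intro t n hn hn'
    obtain ⟨q, s, μ, hqs, hμ, hph⟩ := h.phase h0 h1 h2 hn hn'
    have hμ0 : 0 < μ := by rw [hμ]; positivity
    have hE : μ * (q : ℝ) ^ 2 = lam⁻¹ * Real.exp (excess (prefixWord a (t + 1))) := by
      rw [← increment_mul_sq, hqs, hμ, ← hlam]; ring
    have hX : 0 ≤ μ * (q : ℝ) ^ 2 := by positivity
    have hqs' : q ≤ (B + 1) * s := by
      rw [denominators_succ, contStep, Prod.mk.injEq] at hqs
      obtain ⟨e1, e2⟩ := hqs
      rw [e2] at e1
      have hb := hB (2 * t + 1)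
      have h3 : (denominators a t).1 ≤ s := by
        rw [← e2]
        exact le_add_right (Nat.le_mul_of_pos_left _ (ha _))
      have h4 : a (2 * t + 1) * s ≤ B * s := Nat.mul_le_mul_right _ hb
      rw [← e1, add_mul, one_mul, add_comm]
      exact Nat.add_le_add h4 h3
    have hqr : (q : ℝ) ≤ (B + 1) * s := by exact_mod_cast hqs'
    have hB1 : (0 : ℝ) < B + 1 := by positivity
    have hqB : (q : ℝ) / (B + 1) ≤ s := (div_le_iff₀' hB1).2 hqr
    have hq0 : (0 : ℝ) ≤ q := Nat.cast_nonneg _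
    have hpow : ∀ i ≤ 3 * B, lam ^ (3 * B) ≤ lam ^ i := fun i hi =>
      pow_le_pow_of_le_one h0.le h1.le hi
    rw [← hE]
    rcases hph with ⟨k, hk, u, v, hl⟩ | ⟨j, hj, u, v, hl⟩
    · rw [hl.increment_eq, hl.q_eq, hl.s_eq]
      have e1 := hpow k (by have := hB (2 * (t + 1)); omega)
      have e2 : (q : ℝ) / (B + 1) ≤ (s + k * q : ℕ) := by
        push_cast
        have : (0 : ℝ) ≤ k * q := by positivity
        linarith
      calc lam ^ (3 * B) / (B + 1) * (μ * (q : ℝ) ^ 2)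
          = lam ^ (3 * B) * μ * (q * (q / (B + 1))) := by field_simp
        _ ≤ lam ^ k * μ * (q * ((s + k * q : ℕ) : ℝ)) := by gcongr
    · rw [hl.increment_eq, hl.q_eq, hl.s_eq]
      have hb1 := ha (2 * (t + 1))
      set b := a (2 * (t + 1)) with hb
      have e1 := hpow (b + 2 * j) (by
        have := hB (2 * (t + 1)); have := hB (2 * (t + 1) + 1); omega)
      have e2 : (q : ℝ) / (B + 1) ≤ (b * q + s : ℕ) := by
        push_cast
        have : (0 : ℝ) ≤ b * q := by positivity
        linarith
      have e3 : (q : ℝ) ≤ (q + j * (b * q + s) : ℕ) := by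
        exact_mod_cast Nat.le_add_right _ _
      calc lam ^ (3 * B) / (B + 1) * (μ * (q : ℝ) ^ 2)
          = lam ^ (3 * B) * μ * (q * (q / (B + 1))) := by field_simp
        _ ≤ lam ^ (b + 2 * j) * μ *
            (((q + j * (b * q + s) : ℕ) : ℝ) * ((b * q + s : ℕ) : ℝ)) := by gcongr
  have hlim : Tendsto (fun t => lam ^ (3 * B) / (B + 1) *
      (lam⁻¹ * Real.exp (excess (prefixWord a (t + 1))))) atTop atTop :=
    ((Real.tendsto_exp_atTop.comp (he.comp (tendsto_add_atTop_nat 1))).const_mul_atTop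
      (inv_pos.2 h0)).const_mul_atTop (by positivity)
  rw [tendsto_atTop]
  intro A
  obtain ⟨t₀, ht₀⟩ := eventually_atTop.1 (hlim.eventually_ge_atTop A)
  filter_upwards [eventually_ge_atTop (descentTime a t₀)] with n hn
  obtain ⟨t, ht, hn1, hn2⟩ := exists_descentTime_le ha hn
  exact (ht₀ t ht).trans (hbound t n hn1 hn2)

end IsExpansion

end

/-! ### Periodic expansions and the threshold -/

/-- The periodic sequence of partial quotients that repeats the word `W`. -/
def periodicQuotients (W : List (ℕ × ℕ)) (k : ℕ) : ℕ :=
  if k % 2 = 0 then (W.getD (k / 2 % W.length) (1, 1)).1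
  else (W.getD (k / 2 % W.length) (1, 1)).2

theorem one_le_periodicQuotients {W : List (ℕ × ℕ)} (hW : Admissible W) (hl : 0 < W.length)
    (k : ℕ) : 1 ≤ periodicQuotients W k := by
  have hlt : k / 2 % W.length < W.length := Nat.mod_lt _ hl
  rw [periodicQuotients, List.getD_eq_getElem _ _ hlt]
  have := hW _ (List.getElem_mem hlt)
  split_ifs
  exacts [this.1, this.2]

theorem periodicQuotients_le (W : List (ℕ × ℕ)) (k : ℕ) :
    periodicQuotients W k ≤ wordWeight W + 1 := by
  have key : ∀ i, (W.getD i (1, 1)).1 ≤ wordWeight W + 1 ∧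
      (W.getD i (1, 1)).2 ≤ wordWeight W + 1 := by
    induction W with
    | nil => intro i; simp
    | cons c W ih =>
      intro i
      rw [wordWeight_cons]
      cases i with
      | zero => simp only [List.getD_cons_zero]; omega
      | succ i => have := ih i; simp only [List.getD_cons_succ]; omega
  rw [periodicQuotients]
  split_ifs
  exacts [(key _).1, (key _).2]

theorem periodicQuotients_mod (W : List (ℕ × ℕ)) (k : ℕ) :
    periodicQuotients W (k % (2 * W.length)) = periodicQuotients W k := by
  rw [periodicQuotients, periodicQuotients, Nat.mod_mul_right_div_self, Nat.mod_mod,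
    Nat.mod_mod_of_dvd _ (dvd_mul_right 2 W.length)]

theorem prefixWord_periodic (W : List (ℕ × ℕ)) (t : ℕ) :
    prefixWord (periodicQuotients W) t =
      (List.range t).map fun i => W.getD (i % W.length) (1, 1) := by
  refine List.map_congr_left fun i _ => ?_
  have h1 : 2 * i % 2 = 0 := by omega
  have h2 : 2 * i / 2 = i := by omega
  have h3 : (2 * i + 1) % 2 ≠ 0 := by omega
  have h4 : (2 * i + 1) / 2 = i := by omega
  simp only [periodicQuotients, if_pos h1, if_neg h3, h2, h4]

theorem prefixWord_periodic_add (W : List (ℕ × ℕ)) (m r : ℕ) :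
    prefixWord (periodicQuotients W) (W.length * m + r) =
      wordPow W m ++ prefixWord (periodicQuotients W) r := by
  induction m with
  | zero => simp
  | succ m ih =>
    rw [wordPow_succ, List.append_assoc, ← ih, prefixWord_periodic, prefixWord_periodic,
      show W.length * (m + 1) + r = W.length + (W.length * m + r) by ring, List.range_add,
      List.map_append, List.map_map]
    congr 1
    · refine List.ext_getElem (by simp) fun i h1 h2 => ?_
      simp [Nat.mod_eq_of_lt h2, h2]
    · refine List.map_congr_left fun i _ => ?_
      simp

theorem exists_periodic {W : List (ℕ × ℕ)} (hW : Admissible W) (he : 0 < excess W) :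
    ∃ x ∈ Set.Ioo (0 : ℝ) 1, Irrational x ∧
      Tendsto (fun t : ℕ => weightedSum x (2 * t) / (t : ℝ)) atTop
        (𝓝 (wordWeight W / (W.length : ℝ))) ∧
      HasDerivAtTop (denjoyTichyUitz Real.goldenRatio⁻¹) x := by
  have hl := length_pos_of_excess_pos he
  have hl0 : (0 : ℝ) < W.length := by exact_mod_cast hl
  obtain ⟨x, y, h⟩ := exists_isExpansion_of_periodic (m := 2 * W.length) (by omega)
    (one_le_periodicQuotients hW hl) (periodicQuotients_mod W)
  set P := prefixWord (periodicQuotients W) with hP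
  have hsplit : ∀ t, P t = wordPow W (t / W.length) ++ P (t % W.length) := fun t => by
    rw [hP, ← prefixWord_periodic_add, Nat.div_add_mod]
  refine ⟨x, h.mem_Ioo, h.irrational, ?_, h.hasDerivAtTop (periodicQuotients_le W) ?_⟩
  · -- the deviation from the mean is a function of `t` modulo the length of the word
    set f : ℕ → ℝ := fun r => wordWeight (P r) - r * (wordWeight W / (W.length : ℝ)) with hf
    obtain ⟨D, hD⟩ : ∃ D, ∀ r < W.length, |f r| ≤ D := by
      obtain ⟨D, hD⟩ := ((Finset.range W.length).image fun r => |f r|).bddAbove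
      exact ⟨D, fun r hr => hD (by
        rw [Finset.mem_coe]
        exact Finset.mem_image_of_mem (fun r => |f r|) (Finset.mem_range.2 hr))⟩
    have hlim : Tendsto (fun t : ℕ => f (t % W.length) / (t : ℝ)) atTop (𝓝 0) := by
      refine squeeze_zero_norm (fun t => ?_) (tendsto_const_div_atTop_nhds_zero_nat D)
      rw [norm_div, Real.norm_eq_abs, Real.norm_natCast]
      exact div_le_div_of_nonneg_right (hD _ (Nat.mod_lt _ hl)) t.cast_nonneg
    have hlim' := hlim.const_add (wordWeight W / (W.length : ℝ))
    rw [add_zero] at hlim'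
    refine hlim'.congr' ?_
    filter_upwards [eventually_gt_atTop 0] with t ht
    have ht0 : (0 : ℝ) < t := by exact_mod_cast ht
    have e1 : ((wordWeight (P t) : ℕ) : ℝ) =
        (t / W.length : ℕ) * wordWeight W + wordWeight (P (t % W.length)) := by
      rw [hsplit t, wordWeight_append, wordWeight_wordPow]; push_cast; rfl
    have e2 : (t : ℝ) = W.length * (t / W.length : ℕ) + (t % W.length : ℕ) := by
      exact_mod_cast (Nat.div_add_mod t W.length).symm
    rw [h.weightedSum_eq, ← hP, eq_div_iff ht0.ne', add_mul, div_mul_cancel₀ _ ht0.ne', hf, e1]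
    simp only
    nth_rewrite 1 [e2]
    field_simp
    ring
  · obtain ⟨c, hc⟩ : ∃ c, ∀ r < W.length, c ≤ excess (P r) := by
      obtain ⟨c, hc⟩ := ((Finset.range W.length).image fun r => excess (P r)).bddBelow
      exact ⟨c, fun r hr => hc (by
        rw [Finset.mem_coe]
        exact Finset.mem_image_of_mem (fun r => excess (P r)) (Finset.mem_range.2 hr))⟩
    have hlim : Tendsto (fun t : ℕ => ((t / W.length : ℕ) : ℝ) * excess W + c) atTop atTop :=
      tendsto_atTop_add_const_right _ _ ((tendsto_natCast_atTop_atTop.comp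
        (Nat.tendsto_div_const_atTop hl.ne')).atTop_mul_const he)
    refine tendsto_atTop_mono (fun t => ?_) hlim
    have e1 := mul_excess_le W (t / W.length)
    have e2 := excess_add_le (wordPow W (t / W.length)) (P (t % W.length))
    have e3 := hc _ (Nat.mod_lt t hl)
    rw [← hsplit] at e2
    linarith

/-- If the weight per pair is eventually larger than a number above the critical weight, the excess
of the prefixes tends to `-∞`. -/
theorem IsExpansion.tendsto_excess_atBot {x : ℝ} {a : ℕ → ℕ} {y : ℕ → ℝ} (h : IsExpansion x a y)
    (hlim : (criticalWeight : EReal) <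
      liminf (fun t : ℕ => ((weightedSum x (2 * t) / (t : ℝ) : ℝ) : EReal)) atTop) :
    Tendsto (fun t => excess (prefixWord a t)) atTop atBot := by
  obtain ⟨r₁, hr₁, hlt⟩ := EReal.lt_iff_exists_real_btwn.1 hlim
  obtain ⟨r, hr, hrr₁⟩ := exists_between (EReal.coe_lt_coe_iff.1 hr₁)
  obtain ⟨θ, hθ0, -, hθ⟩ := exists_multiplier hr
  have hbot : Tendsto (fun t : ℕ => -(θ * (r₁ - r) * (t : ℝ))) atTop atBot :=
    tendsto_neg_atTop_atBot.comp
      (tendsto_natCast_atTop_atTop.const_mul_atTop (mul_pos hθ0 (sub_pos.2 hrr₁)))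
  refine tendsto_atBot_mono' _ ?_ hbot
  filter_upwards [eventually_lt_of_lt_liminf hlt, eventually_gt_atTop 0] with t ht ht0
  have ht0' : (0 : ℝ) < t := by exact_mod_cast ht0
  have ht' := EReal.coe_lt_coe_iff.1 ht
  rw [lt_div_iff₀ ht0', h.weightedSum_eq] at ht'
  have e1 := hθ _ (admissible_prefixWord h.one_le t)
  rw [length_prefixWord] at e1
  have e2 := mul_le_mul_of_nonneg_left ht'.le hθ0.le
  linarith

theorem theorem2 :
    ∃ kappa : ℝ,
      IsComputableReal kappa ∧
      13 + 2 / 38 < kappa ∧ kappa < 13 + 2 / 37 ∧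
      (∀ x : ℝ, x ∈ Set.Ioo (0 : ℝ) 1 → Irrational x →
        (kappa : EReal) <
          liminf (fun t : ℕ => ((weightedSum x (2 * t) / (t : ℝ) : ℝ) : EReal)) atTop →
        HasDerivAt (denjoyTichyUitz Real.goldenRatio⁻¹) 0 x) ∧
      (∀ δ : ℝ, 0 < δ →
        ∃ y : ℝ, y ∈ Set.Ioo (0 : ℝ) 1 ∧ Irrational y ∧
          (∃ L : ℝ, Tendsto (fun t : ℕ => weightedSum y (2 * t) / (t : ℝ)) atTop (𝓝 L) ∧
            kappa - δ < L) ∧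
          HasDerivAtTop (denjoyTichyUitz Real.goldenRatio⁻¹) y) := by
  refine ⟨criticalWeight, isComputableReal_criticalWeight, lt_criticalWeight, criticalWeight_lt,
    fun x hx hirr hlim => ?_, fun δ hδ => ?_⟩
  · obtain ⟨a, y, h⟩ := exists_isExpansion hx hirr
    exact h.hasDerivAt_zero (h.tendsto_excess_atBot hlim)
  · obtain ⟨W, hW, he, hlt⟩ := exists_weight_gt_of_lt (sub_lt_self criticalWeight hδ)
    obtain ⟨y, hy, hirr, hlim, hder⟩ := exists_periodic hW he
    exact ⟨y, hy, hirr, ⟨_, hlim, hlt⟩, hder⟩
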